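/- For an integer $n\ge 1$ let $B_n$ be the Boolean lattice of all subsets of $[n]=\{1,\dots,n\}$, regarded as a graph in which two sets are adjacent iff one is strictly contained in the other, and let $L_i=\binom{[n]}{i}$ be its $i$-th layer. For $v\in L_i$ let $N^+(v)$ be the set of neighbours of $v$ in $L_{i+1}$, for $S\subseteq L_i$ let $N^+(S)=\bigcup_{v\in S}N^+(v)$, and let $[S]=\{v\in L_i: N^+(v)\subseteq N^+(S)\}$. A set $A\subseteq L_{i}$ is called $2$-linked if $G^2[A]$ is connected, where $G$ is the subgraph of $B_n$ induced on $L_{i}\cup L_{i+1}$ and $G^2$ is the graph on the same vertex set in which two distinct vertices are adjacent iff their distance in $G$ is at most $2$. For $2\le r\le n$ and integers $a,b,g,h\ge 0$ let $\mathcal H_r(a,b,g,h)$ be the set of all pairs $(A,B)$ with $A\subseteq L_{r-1}$ $2$-linked, $B\subseteq L_{r-2}$, $|[A]|=a$, $|[B]|=b$, $|N^+(A)|=g$, $|N^+(B)|=h$ and $N^+(B)\subseteq A$. **Theorem.** There exist absolute constants $C,C'>0$ such that the following holds for every $n$, every $r\in\{\lfloor n/2\rfloor,\lceil n/2\rceil\}$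 with $r\ge 2$, all integers $a\ge n^2$, $g\ge(1+1/n)a$, $b\ge 0$, $h\ge 0$, and every real $\lambda\ge C\log_2^2 n/\sqrt n$. With $\gamma=C'/\sqrt n$, $t=g-a$ and $t'=h-b$, $$\sum_{(A,B)\in\mathcal H_r(a,b,g,h)}\lambda^{|A|+|B|-h}\;\le\;(1+\lambda)^{\,g-\gamma(t+t')}.$$ -/

import Mathlib

open Finset

namespace BooleanLattice

/-- The layer `L_i` of the Boolean lattice `B_n`: all `i`-element subsets of an `n`-element set. -/
def layer (n i : ℕ) : Finset (Finset (Fin n)) :=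
  powersetCard i univ

/-- The comparability graph of `B_n`: two sets are adjacent iff one is strictly contained in the
other. -/
def comparabilityGraph (n : ℕ) : SimpleGraph (Finset (Fin n)) where
  Adj u v := u ⊂ v ∨ v ⊂ u
  symm := ⟨fun _ _ h => h.symm⟩
  loopless := ⟨fun u h => h.elim (ssubset_irrefl u) (ssubset_irrefl u)⟩

/-- The square `G²` of a graph: distinct vertices are adjacent iff their distance in `G` is at most
`2` (the extended distance is used, so that vertices in different components are at distance
`⊤`). -/
def squareGraph {V : Type*} (G : SimpleGraph V) : SimpleGraph V where
  Adj u v := u ≠ v ∧ G.edist u v ≤ 2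
  symm := ⟨fun _ _ h => ⟨h.1.symm, by rw [SimpleGraph.edist_comm]; exact h.2⟩⟩
  loopless := ⟨fun _ h => h.1 rfl⟩

/-- A vertex set `U` is `2`-linked in `G` if the subgraph `G²[U]` is connected. -/
def TwoLinked {V : Type*} (G : SimpleGraph V) (U : Set V) : Prop :=
  ((squareGraph G).induce U).Connected

/-- The vertex set `L_{i} ∪ L_{i+1}` of two consecutive layers. -/
def twoLayers (n i : ℕ) : Set (Finset (Fin n)) :=
  {v | v ∈ layer n i ∨ v ∈ layer n (i + 1)}

/-- `A` (a subset of `L_i`) is `2`-linked in the graph induced by `B_n` on `L_i ∪ L_{i+1}`. -/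
def LayerTwoLinked (n i : ℕ) (A : Finset (Finset (Fin n))) : Prop :=
  TwoLinked ((comparabilityGraph n).induce (twoLayers n i)) {v | (v : Finset (Fin n)) ∈ A}

/-- The upwards closure `[A] = {v ∈ L_i : N⁺(v) ⊆ N⁺(A)}` of `A ⊆ L_i`. The up-neighbourhood `N⁺`
is Mathlib's `Finset.upShadow`: all sets obtained from a member by adding one new element. -/
def upClosure (n i : ℕ) (A : Finset (Finset (Fin n))) : Finset (Finset (Fin n)) :=
  {v ∈ layer n i | upShadow {v} ⊆ upShadow A}

open Classical in
/-- The family `H_r(a, b, g, h)` of pairs `(A, B)` with `A ⊆ L_{r-1}` `2`-linked, `B ⊆ L_{r-2}`,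
`|[A]| = a`, `|[B]| = b`, `|N⁺(A)| = g`, `|N⁺(B)| = h` and `N⁺(B) ⊆ A` (meant for `2 ≤ r ≤ n`). -/
noncomputable def pairFamily (n r a b g h : ℕ) :
    Finset (Finset (Finset (Fin n)) × Finset (Finset (Fin n))) :=
  {p ∈ (layer n (r - 1)).powerset ×ˢ (layer n (r - 2)).powerset |
    LayerTwoLinked n (r - 1) p.1 ∧
    #(upClosure n (r - 1) p.1) = a ∧ #(upClosure n (r - 2) p.2) = b ∧
    #(upShadow p.1) = g ∧ #(upShadow p.2) = h ∧ upShadow p.2 ⊆ p.1}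

end BooleanLattice

/-! The pair `(A, B)` is treated as one object. In the graph joining `L_{r-1} ∪ L_{r-2}` to upper
shadows, `C = [A] ∪ [B]` is a closed set with `a + b` elements, `g + h` neighbours and excess `T = t
+ t'`. For any `S`, the pairs inside `S` have total weight at most `(1 + λ) ^ (#S - h)`: for fixed
`B` sum over `A` between `N⁺(B)` and `S`, then over `B` (`sum_pairs_le`). So it suffices to cover
all `C` by few containers `S` with `#S ≤ g + h - T / √n`; the number of containers may use up half
of the gain.

The containers come from approximations `(F, S)` with `F ⊆ nb C` and `C ⊆ S`, in which each `x ∈ S`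
has at most `ψ` neighbours outside `F` and each `y ∉ F` has at most `n / 4` neighbours in `S`. A
first approximation, at `ψ = n / 4`, is encoded by a certificate of `O(T log n / n)` vertices close
to `C` (`exists_certificate`). Since `A` is 2-linked, the certificate is linked at bounded distance,
so certificates are counted by walks, at cost `exp (O(T log² n / n))`.

The scale is then refined. Weighted double counting gives `#S ≤ #(nb C) - #(nb C \ F) / 2 + 4ψT / n`
(`IsApprox.card_le`). If `nb C \ F` is large compared with `ψT / n`, then `S` is already a good
container. Otherwise `O(T / n)` further vertices of `C` halve `ψ`, at cost `exp (O(T log n / n))`,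
and this happens `O(log n)` times. Once `ψ ≤ √n`, either `S` is small or `nb C \ F` has `O(T / √n)`
elements and can be listed outright; that determines `C`, whose size is smaller than that of its
neighbourhood by all of `T`. Every cost is beaten because `log (1 + λ)` is at least a large multiple
of `log² n / √n`. -/

/-- A bipartite graph between `X` and its neighbours in which every vertex of `X` has total
neighbour weight one and every vertex on the other side satisfies the dual inequality, the weights
being of order `1 / n`, together with a metric in which edges are short. -/
structure UpGraph (V : Type*) [DecidableEq V] where
  /-- the lower side -/
  X : Finset V
  /-- the upper neighbourhoods -/
  N : V → Finset V
  /-- the weights of the upper vertices -/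
  w : V → ℝ
  /-- the order of magnitude of the degrees -/
  n : ℕ
  /-- the metric -/
  dist : V → V → ℕ
  three_le : 3 ≤ n
  w_nonneg : ∀ y, 0 ≤ w y
  sum_w : ∀ x ∈ X, ∑ y ∈ N x, w y = 1
  w_mul_le : ∀ y, w y * (#{x ∈ X | y ∈ N x} : ℝ) ≤ 1
  le_w : ∀ x ∈ X, ∀ y ∈ N x, 1 ≤ n * w y
  w_le : ∀ x ∈ X, ∀ y ∈ N x, n * w y ≤ 2
  codegree : ∀ x ∈ X, ∀ x' ∈ X, x ≠ x' → #(N x ∩ N x') ≤ 1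
  dist_self : ∀ x, dist x x = 0
  dist_comm : ∀ x y, dist x y = dist y x
  dist_triangle : ∀ x y z, dist x z ≤ dist x y + dist y z
  dist_le_one : ∀ x, ∀ y ∈ N x, dist x y ≤ 1

/-! ### Weighted double counting, approximations and greedy covers -/

namespace UpGraph

variable {V : Type*} [DecidableEq V] (Γ : UpGraph V)

/-- The neighbours of `y` in `S`. -/
def fib (S : Finset V) (y : V) : Finset V := {x ∈ S | y ∈ Γ.N x}

/-- The neighbourhood of a set. -/
def nb (S : Finset V) : Finset V := S.biUnion Γ.N

/-- Sets `C ⊆ X` that contain every vertex whose neighbourhood lies in that of `C`. -/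
def IsClosedSet (C : Finset V) : Prop := C ⊆ Γ.X ∧ ∀ x ∈ Γ.X, Γ.N x ⊆ Γ.nb C → x ∈ C

variable {Γ}

lemma mem_fib {S : Finset V} {x y : V} : x ∈ Γ.fib S y ↔ x ∈ S ∧ y ∈ Γ.N x := by
  simp [fib]

lemma mem_nb {S : Finset V} {y : V} : y ∈ Γ.nb S ↔ ∃ x ∈ S, y ∈ Γ.N x := by
  simp [nb]

lemma fib_mono {S S' : Finset V} (h : S ⊆ S') (y : V) : Γ.fib S y ⊆ Γ.fib S' y :=
  filter_subset_filter _ h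

lemma nb_mono {S S' : Finset V} (h : S ⊆ S') : Γ.nb S ⊆ Γ.nb S' :=
  biUnion_subset_biUnion_of_subset_left _ h

lemma N_subset_nb {S : Finset V} {x : V} (h : x ∈ S) : Γ.N x ⊆ Γ.nb S :=
  subset_biUnion_of_mem Γ.N h

lemma n_pos : (0 : ℝ) < Γ.n := by
  have := Γ.three_le
  exact_mod_cast (by omega : 0 < Γ.n)

lemma three_le_n : (3 : ℝ) ≤ Γ.n := by exact_mod_cast Γ.three_le

lemma sum_w_mul_card_fib (S P : Finset V) :
    ∑ y ∈ P, Γ.w y * (#(Γ.fib S y) : ℝ) = ∑ x ∈ S, ∑ y ∈ Γ.N x ∩ P, Γ.w y := by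
  have h1 : ∀ y ∈ P, Γ.w y * (#(Γ.fib S y) : ℝ) = ∑ x ∈ S, if y ∈ Γ.N x then Γ.w y else 0 := by
    intro y _
    rw [← sum_filter, sum_const, nsmul_eq_mul, mul_comm]
    rfl
  rw [sum_congr rfl h1, sum_comm]
  refine sum_congr rfl fun x _ => ?_
  rw [← sum_filter, filter_mem_eq_inter, inter_comm]

lemma card_eq_sum {S P : Finset V} (hS : S ⊆ Γ.X) (hP : Γ.nb S ⊆ P) :
    (#S : ℝ) = ∑ y ∈ P, Γ.w y * (#(Γ.fib S y) : ℝ) := by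
  rw [sum_w_mul_card_fib]
  have : ∀ x ∈ S, ∑ y ∈ Γ.N x ∩ P, Γ.w y = 1 := by
    intro x hx
    rw [inter_eq_left.2 ((N_subset_nb hx).trans hP), Γ.sum_w x (hS hx)]
  rw [sum_congr rfl this]
  simp

lemma w_mul_card_fib_le {S : Finset V} (hS : S ⊆ Γ.X) (y : V) :
    Γ.w y * (#(Γ.fib S y) : ℝ) ≤ 1 := by
  refine le_trans (mul_le_mul_of_nonneg_left ?_ (Γ.w_nonneg y)) (Γ.w_mul_le y)
  exact_mod_cast card_le_card (fib_mono hS y)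

lemma w_mul_card_fib_nonneg (S : Finset V) (y : V) : 0 ≤ Γ.w y * (#(Γ.fib S y) : ℝ) :=
  mul_nonneg (Γ.w_nonneg y) (Nat.cast_nonneg _)

lemma card_fib_sdiff {C S : Finset V} (h : C ⊆ S) (y : V) :
    (#(Γ.fib (S \ C) y) : ℝ) = #(Γ.fib S y) - #(Γ.fib C y) := by
  have : Γ.fib (S \ C) y = Γ.fib S y \ Γ.fib C y := by
    ext x; simp only [mem_fib, mem_sdiff]; tauto
  rw [this, cast_card_sdiff (fib_mono h y)]

/-- Each element of `C` distributes weight one over its neighbours, so the excess is the sum of the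
nonnegative deficits of the vertices of `nb C`. -/
lemma excess_eq {C : Finset V} (hC : C ⊆ Γ.X) :
    (#(Γ.nb C) : ℝ) - #C = ∑ y ∈ Γ.nb C, (1 - Γ.w y * (#(Γ.fib C y) : ℝ)) := by
  rw [sum_sub_distrib, ← card_eq_sum hC subset_rfl]
  simp

/-- The weighted number of edges from `nb C` to `X \ C` is at most the excess of `C`. -/
lemma sum_w_fib_sdiff_le {C S P : Finset V} (hS : S ⊆ Γ.X) (hCS : C ⊆ S) (hP : P ⊆ Γ.nb C) :
    ∑ y ∈ P, Γ.w y * (#(Γ.fib (S \ C) y) : ℝ) ≤ (#(Γ.nb C) : ℝ) - #C := by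
  rw [excess_eq (hCS.trans hS)]
  refine le_trans (sum_le_sum_of_subset_of_nonneg hP fun y _ _ => w_mul_card_fib_nonneg _ _) ?_
  refine sum_le_sum fun y _ => ?_
  rw [card_fib_sdiff hCS]
  have := w_mul_card_fib_le hS y
  linarith

lemma sum_w_le {x : V} (hx : x ∈ Γ.X) {P : Finset V} (hP : P ⊆ Γ.N x) :
    ∑ y ∈ P, Γ.w y ≤ 2 / Γ.n * (#P : ℝ) := by
  rw [mul_comm, ← nsmul_eq_mul]
  refine sum_le_card_nsmul _ _ _ fun y hy => ?_
  rw [le_div_iff₀ n_pos, mul_comm]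
  exact Γ.w_le x hx y (hP hy)

lemma card_N_le {x : V} (hx : x ∈ Γ.X) : #(Γ.N x) ≤ Γ.n := by
  have h : (#(Γ.N x) : ℝ) ≤ ∑ y ∈ Γ.N x, Γ.n * Γ.w y := by
    have := card_nsmul_le_sum (Γ.N x) (fun y => Γ.n * Γ.w y) 1 (Γ.le_w x hx)
    simpa using this
  rw [← mul_sum, Γ.sum_w x hx, mul_one] at h
  exact_mod_cast h

lemma le_card_N {x : V} (hx : x ∈ Γ.X) : (Γ.n : ℝ) / 2 ≤ #(Γ.N x) := by
  have h := sum_w_le hx (subset_refl (Γ.N x))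
  rw [Γ.sum_w x hx, div_mul_eq_mul_div, le_div_iff₀ n_pos] at h
  linarith

lemma card_nb_le {S : Finset V} (hS : S ⊆ Γ.X) : (#(Γ.nb S) : ℝ) ≤ Γ.n * #S := by
  have : #(Γ.nb S) ≤ #S * Γ.n := card_biUnion_le_card_mul _ _ _ fun x hx => card_N_le (hS hx)
  rw [mul_comm]
  exact_mod_cast this

/-- Supersets of `C` whose members send at least half of their weight into `nb C` exceed `C` by at
most twice its excess. -/
lemma card_sdiff_le {C S F : Finset V} {ψ : ℝ} (hS : S ⊆ Γ.X) (hCS : C ⊆ S) (hF : F ⊆ Γ.nb C)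
    (hψ : ψ ≤ Γ.n / 4) (h : ∀ x ∈ S, (#(Γ.N x \ F) : ℝ) ≤ ψ) :
    (#(S \ C) : ℝ) ≤ 2 * ((#(Γ.nb C) : ℝ) - #C) := by
  have h1 := sum_w_fib_sdiff_le hS hCS hF
  rw [sum_w_mul_card_fib] at h1
  have h2 : (#(S \ C) : ℝ) * (1 / 2) ≤ ∑ x ∈ S \ C, ∑ y ∈ Γ.N x ∩ F, Γ.w y := by
    rw [← nsmul_eq_mul]
    refine card_nsmul_le_sum _ _ _ fun x hx => ?_
    have hxS := (mem_sdiff.1 hx).1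
    have h3 := sum_inter_add_sum_sdiff (Γ.N x) F Γ.w
    rw [Γ.sum_w x (hS hxS)] at h3
    have h4 : ∑ y ∈ Γ.N x \ F, Γ.w y ≤ 2 / Γ.n * (#(Γ.N x \ F) : ℝ) :=
      sum_w_le (hS hxS) sdiff_subset
    have h5 : 2 / Γ.n * (#(Γ.N x \ F) : ℝ) ≤ 1 / 2 := by
      rw [div_mul_eq_mul_div, div_le_iff₀ n_pos]
      have := h x hxS
      linarith
    linarith
  linarith

variable (Γ) in
/-- The pair `(F, S)` is an approximation at scale `ψ`. -/
structure IsApprox (ψ : ℝ) (F S : Finset V) : Prop where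
  subset : S ⊆ Γ.X
  lower : ∀ x ∈ S, (#(Γ.N x \ F) : ℝ) ≤ ψ
  upper : ∀ y ∉ F, (#(Γ.fib S y) : ℝ) ≤ Γ.n / 4

lemma w_mul_card_fib_le_half {S : Finset V} (hS : S ⊆ Γ.X) {y : V}
    (h : (#(Γ.fib S y) : ℝ) ≤ Γ.n / 4) : Γ.w y * (#(Γ.fib S y) : ℝ) ≤ 1 / 2 := by
  rcases (Γ.fib S y).eq_empty_or_nonempty with he | ⟨x, hx⟩
  · simp [he]
  · have hx' := mem_fib.1 hx
    have h1 := Γ.w_le x (hS hx'.1) y hx'.2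
    have h2 := mul_le_mul_of_nonneg_left h (Γ.w_nonneg y)
    nlinarith

/-- Each `x ∈ S` distributes weight one over its neighbours. A vertex of `F` receives at most 1 and
a vertex of `nb C \ F` at most `1 / 2`. What leaves `nb C` comes only from `S \ C`, at most `2ψ / n`
per element, and `S \ C` has at most twice the excess many elements. -/
lemma IsApprox.card_le {C S F : Finset V} {ψ : ℝ} (hA : Γ.IsApprox ψ F S) (hCS : C ⊆ S)
    (hF : F ⊆ Γ.nb C) (hψ : ψ ≤ Γ.n / 4) (hψ0 : 0 ≤ ψ) :
    (#S : ℝ) ≤ #(Γ.nb C) - (#(Γ.nb C \ F) : ℝ) / 2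
      + 4 * ψ / Γ.n * ((#(Γ.nb C) : ℝ) - #C) := by
  have hsd := card_sdiff_le hA.subset hCS hF hψ hA.lower
  have hG : Γ.nb C ⊆ Γ.nb S := nb_mono hCS
  rw [card_eq_sum hA.subset subset_rfl, ← sum_sdiff hG, ← sum_sdiff hF]
  have h1 : ∑ y ∈ F, Γ.w y * (#(Γ.fib S y) : ℝ) ≤ #F := by
    have := sum_le_card_nsmul F (fun y => Γ.w y * (#(Γ.fib S y) : ℝ)) 1
      fun y _ => w_mul_card_fib_le hA.subset y
    simpa using this
  have h2 : ∑ y ∈ Γ.nb C \ F, Γ.w y * (#(Γ.fib S y) : ℝ) ≤ (#(Γ.nb C \ F) : ℝ) * (1 / 2) := by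
    rw [← nsmul_eq_mul]
    refine sum_le_card_nsmul _ _ _ fun y hy => ?_
    exact w_mul_card_fib_le_half hA.subset (hA.upper y (mem_sdiff.1 hy).2)
  have h3 : ∑ y ∈ Γ.nb S \ Γ.nb C, Γ.w y * (#(Γ.fib S y) : ℝ)
      ≤ 2 / Γ.n * ψ * #(S \ C) := by
    have e1 : ∀ y ∈ Γ.nb S \ Γ.nb C, Γ.w y * (#(Γ.fib S y) : ℝ)
        = Γ.w y * (#(Γ.fib (S \ C) y) : ℝ) := by
      intro y hy
      rw [card_fib_sdiff hCS]
      have : Γ.fib C y = ∅ := by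
        rw [eq_empty_iff_forall_notMem]
        intro x hx
        exact (mem_sdiff.1 hy).2 (mem_nb.2 ⟨x, (mem_fib.1 hx)⟩)
      simp [this]
    rw [sum_congr rfl e1, sum_w_mul_card_fib, mul_comm, ← nsmul_eq_mul]
    refine sum_le_card_nsmul _ _ _ fun x hx => ?_
    have hxS := (mem_sdiff.1 hx).1
    refine (sum_w_le (hA.subset hxS) inter_subset_left).trans ?_
    refine mul_le_mul_of_nonneg_left ?_ (by positivity)
    refine le_trans ?_ (hA.lower x hxS)
    have : Γ.N x ∩ (Γ.nb S \ Γ.nb C) ⊆ Γ.N x \ F := by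
      intro y hy
      simp only [mem_inter, mem_sdiff] at hy ⊢
      exact ⟨hy.1, fun hyF => hy.2.2 (hF hyF)⟩
    exact_mod_cast card_le_card this
  have h4 : (#(Γ.nb C \ F) : ℝ) = #(Γ.nb C) - #F := cast_card_sdiff hF
  have h5 : 2 / Γ.n * ψ * #(S \ C) ≤ 2 / Γ.n * ψ * (2 * ((#(Γ.nb C) : ℝ) - #C)) :=
    mul_le_mul_of_nonneg_left hsd (by have := Γ.n_pos; positivity)
  have h6 : 2 / Γ.n * ψ * (2 * ((#(Γ.nb C) : ℝ) - #C))
      = 4 * ψ / Γ.n * ((#(Γ.nb C) : ℝ) - #C) := by ring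
  linarith

/-- Greedy choice of a small subset covering most of every neighbourhood. -/
lemma exists_greedy_cover {W : Type*} (C : Finset W) (f : W → Finset V) (F : Finset V) {ψ : ℝ}
    (hψ : 0 ≤ ψ) :
    ∃ U ⊆ C, (∀ x ∈ C, (#(f x \ (F ∪ U.biUnion f)) : ℝ) ≤ ψ) ∧
      ψ * #U ≤ #(C.biUnion f \ F) := by
  classical
  -- Take `U` largest among the sets whose elements cover, on average, at least `ψ` vertices outside
  -- `F`. An `x` violating the conclusion could be added.
  obtain ⟨U, hU, hmax⟩ := exists_max_image
    {U ∈ C.powerset | ψ * (#U : ℝ) ≤ #(U.biUnion f \ F)} card ⟨∅, by simp⟩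
  simp only [mem_filter, mem_powerset] at hU hmax
  refine ⟨U, hU.1, ?_, hU.2.trans ?_⟩
  · intro x hx
    by_contra! hlt
    have hxU : x ∉ U := by
      intro hxU
      have : f x \ (F ∪ U.biUnion f) = ∅ := by
        rw [sdiff_eq_empty_iff_subset]
        exact (subset_biUnion_of_mem f hxU).trans subset_union_right
      rw [this] at hlt
      simp at hlt
      linarith
    have h := hmax (insert x U) ⟨insert_subset hx hU.1, by
      have e : (insert x U).biUnion f \ F ⊇ (f x \ (F ∪ U.biUnion f)) ∪ (U.biUnion f \ F) := by
        intro y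
        simp only [biUnion_insert, mem_union, mem_sdiff]
        tauto
      have hd : Disjoint (f x \ (F ∪ U.biUnion f)) (U.biUnion f \ F) := by
        rw [disjoint_left]
        intro y
        simp only [mem_union, mem_sdiff]
        tauto
      have h2 := card_le_card e
      rw [card_union_of_disjoint hd] at h2
      rw [card_insert_of_notMem hxU]
      have h3 : (#(f x \ (F ∪ U.biUnion f)) : ℝ) + #(U.biUnion f \ F)
          ≤ #((insert x U).biUnion f \ F) := by exact_mod_cast h2
      push_cast
      linarith [hU.2]⟩
    rw [card_insert_of_notMem hxU] at h
    omega
  · exact_mod_cast card_le_card (sdiff_subset_sdiff (biUnion_subset_biUnion_of_subset_left _ hU.1)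
      subset_rfl)

end UpGraph

/-! ### Small sets that almost dominate the heavy vertices -/

namespace UpGraph

variable {V : Type*} [DecidableEq V] {Γ : UpGraph V}

/-- If every set `Q y` contains a proportion at least `1 - ρ` of `G`, then `m` elements of `G` meet
all but a proportion `ρ ^ m` of these sets, while keeping the cost `e` close to its average. -/
lemma exists_hitting_set {G : Finset V} (hG : G.Nonempty) {e : V → ℝ} (he : ∀ y, 0 ≤ e y)
    {Q : V → Finset V} {ρ : ℝ} (hρ : 0 ≤ ρ) (m : ℕ) :
    ∀ H : Finset V, (∀ y ∈ H, (#(G \ Q y) : ℝ) ≤ ρ * #G) →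
    ∃ T ⊆ G, #T ≤ m ∧ ∑ y ∈ T, e y + (#{y ∈ H | Disjoint T (Q y)} : ℝ)
      ≤ m * ((∑ y ∈ G, e y) / #G) + ρ ^ m * #H := by
  have hG0 : (0 : ℝ) < #G := by exact_mod_cast hG.card_pos
  induction m with
  | zero => exact fun H _ => ⟨∅, by simp, by simp, by simp⟩
  | succ m ih =>
    intro H hH
    -- Derandomized sampling: some `z` does at least as well as a uniform element of `G` for its
    -- cost plus the misses, discounted by the `m` choices still to come.
    obtain ⟨z, hz, hle⟩ : ∃ z ∈ G, e z + ρ ^ m * (#{y ∈ H | z ∉ Q y} : ℝ)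
        ≤ (∑ y ∈ G, e y) / #G + ρ ^ (m + 1) * #H := by
      refine exists_le_of_sum_le hG ?_
      rw [sum_add_distrib, ← mul_sum, sum_const, nsmul_eq_mul, mul_add, mul_div_cancel₀ _ hG0.ne']
      have h1 : ∑ z ∈ G, (#{y ∈ H | z ∉ Q y} : ℝ) = ∑ y ∈ H, (#(G \ Q y) : ℝ) := by
        have := sum_card_bipartiteAbove_eq_sum_card_bipartiteBelow (s := G) (t := H)
          (fun z y => z ∉ Q y)
        have h2 : ∀ y, bipartiteBelow (fun z y => z ∉ Q y) G y = G \ Q y := by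
          intro y; ext z; simp [bipartiteBelow]
        simp only [h2] at this
        exact_mod_cast this
      have h2 : ∑ y ∈ H, (#(G \ Q y) : ℝ) ≤ #H * (ρ * #G) := by
        rw [← nsmul_eq_mul]
        exact sum_le_card_nsmul _ _ _ hH
      rw [h1]
      have := mul_le_mul_of_nonneg_left h2 (pow_nonneg hρ m)
      have e1 : ρ ^ m * (#H * (ρ * #G)) = #G * (ρ ^ (m + 1) * #H) := by ring
      linarith
    obtain ⟨T, hT, hTm, hTs⟩ := ih {y ∈ H | z ∉ Q y} fun y hy => hH y (mem_filter.1 hy).1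
    refine ⟨insert z T, insert_subset hz hT, (card_insert_le _ _).trans (by omega), ?_⟩
    have h1 : ∑ y ∈ insert z T, e y ≤ e z + ∑ y ∈ T, e y := by
      by_cases hzT : z ∈ T
      · rw [insert_eq_of_mem hzT]; linarith [he z]
      · rw [sum_insert hzT]
    have h2 : ({y ∈ H | Disjoint (insert z T) (Q y)} : Finset V)
        ⊆ {y ∈ {y ∈ H | z ∉ Q y} | Disjoint T (Q y)} := by
      intro y
      simp only [mem_filter, disjoint_insert_left]
      tauto
    have h3 : (#{y ∈ H | Disjoint (insert z T) (Q y)} : ℝ)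
        ≤ #{y ∈ {y ∈ H | z ∉ Q y} | Disjoint T (Q y)} := by exact_mod_cast card_le_card h2
    push_cast
    linarith

variable (Γ) in
/-- The members of `nb C` with many neighbours in `C`. -/
noncomputable def heavy (C : Finset V) : Finset V :=
  {y ∈ Γ.nb C | (Γ.n : ℝ) / 4 < #(Γ.fib C y)}

/-- A vertex of `nb C` that is not heavy has deficit at least `1 / 2`, and the deficits add up to
the excess. -/
lemma card_nb_sdiff_heavy_le {C : Finset V} (hC : C ⊆ Γ.X) :
    (#(Γ.nb C \ Γ.heavy C) : ℝ) ≤ 2 * ((#(Γ.nb C) : ℝ) - #C) := by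
  rw [excess_eq hC]
  have h1 : (#(Γ.nb C \ Γ.heavy C) : ℝ) * (1 / 2)
      ≤ ∑ y ∈ Γ.nb C \ Γ.heavy C, (1 - Γ.w y * (#(Γ.fib C y) : ℝ)) := by
    rw [← nsmul_eq_mul]
    refine card_nsmul_le_sum _ _ _ fun y hy => ?_
    have hy' : (#(Γ.fib C y) : ℝ) ≤ Γ.n / 4 := by
      simp only [heavy, mem_sdiff, mem_filter, not_and, not_lt] at hy
      exact hy.2 hy.1
    have := w_mul_card_fib_le_half hC hy'
    linarith
  have h2 := sum_le_sum_of_subset_of_nonneg (s := Γ.nb C \ Γ.heavy C) (t := Γ.nb C)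
    (f := fun y => (1 - Γ.w y * (#(Γ.fib C y) : ℝ))) sdiff_subset
    fun y _ _ => by have := w_mul_card_fib_le hC y; linarith
  linarith

/-- Heavy vertices have many second neighbours. -/
lemma le_card_nb_fib {C : Finset V} (hC : C ⊆ Γ.X) {y : V} (hy : y ∈ Γ.heavy C) :
    (Γ.n : ℝ) ^ 2 / 24 ≤ #(Γ.nb (Γ.fib C y)) := by
  have hn := Γ.three_le_n
  have h4 : (Γ.n : ℝ) / 4 < #(Γ.fib C y) := (mem_filter.1 hy).2
  have hsub : (Γ.fib C y).biUnion (fun x => (Γ.N x).erase y) ⊆ Γ.nb (Γ.fib C y) :=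
    biUnion_mono fun x _ => erase_subset _ _
  -- Two distinct neighbours of `y` have at most one common neighbour, which is `y` itself.
  have hdis : (Γ.fib C y : Set V).PairwiseDisjoint fun x => (Γ.N x).erase y := by
    intro x hx x' hx' hne
    rw [mem_coe, mem_fib] at hx hx'
    have hc := Γ.codegree x (hC hx.1) x' (hC hx'.1) hne
    refine disjoint_left.2 fun v hv hv' => ?_
    rw [mem_erase] at hv hv'
    exact hv.1 (card_le_one.1 hc v (mem_inter.2 ⟨hv.2, hv'.2⟩) y (mem_inter.2 ⟨hx.2, hx'.2⟩))
  have h1 := card_le_card hsub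
  rw [card_biUnion hdis] at h1
  -- Degrees are at least `n / 2`, and `n / 2 - 1 ≥ n / 6` because `n ≥ 3`.
  have h2 : (#(Γ.fib C y) : ℝ) * (Γ.n / 6) ≤ ∑ x ∈ Γ.fib C y, (#((Γ.N x).erase y) : ℝ) := by
    rw [← nsmul_eq_mul]
    refine card_nsmul_le_sum _ _ _ fun x hx => ?_
    rw [mem_fib] at hx
    rw [cast_card_erase_of_mem hx.2]
    have := le_card_N (hC hx.1)
    linarith
  have h3 : ∑ x ∈ Γ.fib C y, (#((Γ.N x).erase y) : ℝ) ≤ #(Γ.nb (Γ.fib C y)) := by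
    exact_mod_cast h1
  nlinarith

/-- Weights on `nb C` are at least `1 / n`, so few edges leave `C`. Divided by `#(nb C)`, this is
the mean cost of one sample in `exists_dominating`. -/
lemma sum_card_fib_sdiff_le {C : Finset V} (hC : C ⊆ Γ.X) :
    ∑ y ∈ Γ.nb C, (#(Γ.fib (Γ.X \ C) y) : ℝ) ≤ Γ.n * ((#(Γ.nb C) : ℝ) - #C) := by
  refine le_trans ?_ (mul_le_mul_of_nonneg_left (sum_w_fib_sdiff_le subset_rfl hC subset_rfl)
    Γ.n_pos.le)
  rw [mul_sum]
  refine sum_le_sum fun y hy => ?_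
  obtain ⟨x, hx, hxy⟩ := mem_nb.1 hy
  have h1 := Γ.le_w x (hC hx) y hxy
  have h2 : (0 : ℝ) ≤ #(Γ.fib (Γ.X \ C) y) := Nat.cast_nonneg _
  nlinarith

/-- A quadratic excess makes `T log n / n` bounded below, so that rounding the sample size up to an
integer is harmless. -/
lemma one_le_mul_of_sq_le {n T ℓ : ℝ} (hn : 3 ≤ n) (hℓ : 1 ≤ ℓ) (hTn : n ^ 2 ≤ 96 * T) :
    1 ≤ 32 * (T * ℓ / n) := by
  have hT0 : 0 < T := by nlinarith
  rw [← mul_div_assoc, one_le_div (by linarith)]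
  nlinarith [mul_le_mul_of_nonneg_left hℓ hT0.le]

lemma sample_size_le {n T ℓ g : ℝ} (hn : 3 ≤ n) (hℓ : 1 ≤ ℓ) (hTn : n ^ 2 ≤ 96 * T)
    (hgT : g ≤ (n + 1) * T) : 48 * g * ℓ / n ^ 2 + 1 ≤ 96 * (T * ℓ / n) := by
  have hn0 : 0 < n := by linarith
  have hT0 : 0 < T := by nlinarith
  have h1L := one_le_mul_of_sq_le hn hℓ hTn
  have hA : 48 * g * ℓ / n ^ 2 ≤ 64 * (T * ℓ / n) := by
    have h1 : g ≤ 4 / 3 * n * T := by nlinarith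
    have h2 := mul_le_mul_of_nonneg_right h1 (by linarith : 0 ≤ ℓ)
    calc 48 * g * ℓ / n ^ 2 ≤ 64 * (n * T * ℓ) / n ^ 2 := by
          gcongr ?_ / _
          linarith
      _ = 64 * (T * ℓ / n) := by
          field_simp
  linarith

lemma sample_cost_le {n T ℓ g : ℝ} (hn : 3 ≤ n) (hℓ : 1 ≤ ℓ) (hT0 : 0 < T) (hgn : n ^ 2 ≤ g) :
    (48 * g * ℓ / n ^ 2 + 1) * (n * T / g) ≤ 49 * (T * ℓ / n) := by
  have hn0 : 0 < n := by linarith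
  have hg0 : 0 < g := lt_of_lt_of_le (by positivity) hgn
  have e : (48 * g * ℓ / n ^ 2 + 1) * (n * T / g) = 48 * (T * ℓ / n) + n * T / g := by
    field_simp
  have h1 : n * T / g ≤ T * ℓ / n := by
    rw [div_le_div_iff₀ hg0 hn0]
    have h2 : T * n ^ 2 ≤ T * g := by gcongr
    have h3 : T * g ≤ T * g * ℓ := le_mul_of_one_le_right (by positivity) hℓ
    linarith
  linarith

lemma sample_rest_le {n T ℓ : ℝ} (hn : 3 ≤ n) (hℓ : 1 ≤ ℓ) (hT0 : 0 < T) :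
    1 / n ^ 2 * ((n + 1) * T) ≤ 2 * (T * ℓ / n) := by
  have hn0 : 0 < n := by linarith
  rw [← mul_div_assoc, one_div_mul_eq_div, div_le_div_iff₀ (by positivity) hn0]
  have h1 : T ≤ T * ℓ := le_mul_of_one_le_right hT0.le hℓ
  have h2 : (n + 1) * n ≤ 2 * n ^ 2 := by nlinarith
  calc (n + 1) * T * n = T * ((n + 1) * n) := by ring
    _ ≤ (T * ℓ) * (2 * n ^ 2) := by gcongr
    _ = _ := by ring

lemma one_sub_pow_le {n ℓ g : ℝ} {m : ℕ} (hn : 3 ≤ n) (hℓ : ℓ = Real.log n) (hgn : n ^ 2 ≤ g)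
    (hm : 48 * g * ℓ / n ^ 2 ≤ m) : (1 - n ^ 2 / 24 / g) ^ m ≤ 1 / n ^ 2 := by
  have hn0 : 0 < n := by linarith
  have hg0 : 0 < g := lt_of_lt_of_le (by positivity) hgn
  have h0 : 0 ≤ 1 - n ^ 2 / 24 / g := by
    rw [sub_nonneg, div_le_one hg0]; linarith [sq_nonneg n]
  calc (1 - n ^ 2 / 24 / g) ^ m ≤ (Real.exp (-(n ^ 2 / 24 / g))) ^ m :=
        pow_le_pow_left₀ h0 (Real.one_sub_le_exp_neg _) m
    _ = Real.exp (-(m * (n ^ 2 / 24 / g))) := by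
        rw [← Real.exp_nat_mul]; congr 1; ring
    _ ≤ Real.exp (-(2 * ℓ)) := by
        rw [Real.exp_le_exp, neg_le_neg_iff]
        calc 2 * ℓ = 48 * g * ℓ / n ^ 2 * (n ^ 2 / 24 / g) := by field_simp; ring
          _ ≤ _ := mul_le_mul_of_nonneg_right hm (by positivity)
    _ = 1 / n ^ 2 := by
        rw [Real.exp_neg, two_mul, Real.exp_add, hℓ, Real.exp_log hn0, pow_two, one_div]

/-- A small set `T ⊆ nb C` which sends few edges out of `C` and almost dominates the heavy vertices
at distance two. -/
lemma exists_dominating {C : Finset V} (hC : C ⊆ Γ.X) {T : ℝ}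
    (hT : T = (#(Γ.nb C) : ℝ) - #C) (hCT : (#C : ℝ) ≤ Γ.n * T) (hG : Γ.n ^ 2 ≤ #(Γ.nb C))
    (hTn : (Γ.n : ℝ) ^ 2 ≤ 96 * T) :
    ∃ D ⊆ Γ.nb C, (#D : ℝ) ≤ 96 * (T * Real.log Γ.n / Γ.n) ∧
      ∑ y ∈ D, (#(Γ.fib (Γ.X \ C) y) : ℝ)
        + (#{y ∈ Γ.heavy C | Disjoint D (Γ.nb (Γ.fib C y))} : ℝ)
          ≤ 51 * (T * Real.log Γ.n / Γ.n) := by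
  have hn := Γ.three_le_n
  have hn0 := Γ.n_pos
  set n : ℝ := (Γ.n : ℝ) with hndef
  set ℓ := Real.log n with hℓ
  have hℓ1 : 1 ≤ ℓ := by
    rw [hℓ, Real.le_log_iff_exp_le hn0]
    exact (Real.exp_one_lt_d9.le.trans (by norm_num)).trans hn
  set g : ℝ := (#(Γ.nb C) : ℝ) with hg
  have hgn : n ^ 2 ≤ g := by rw [hg, hndef]; exact_mod_cast hG
  have hg0 : 0 < g := lt_of_lt_of_le (by positivity) hgn
  have hT0 : 0 < T := by nlinarith
  have hgT : g ≤ (n + 1) * T := by linarith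
  have hGne : (Γ.nb C).Nonempty := by
    rw [← card_pos]
    exact_mod_cast (hg ▸ hg0)
  set ρ : ℝ := 1 - n ^ 2 / 24 / g with hρ
  have hρ0 : 0 ≤ ρ := by
    rw [hρ, sub_nonneg, div_le_one hg0]; linarith [sq_nonneg n]
  -- One sample hits the second neighbourhood of a heavy vertex with probability at least `n² / (24
  -- g)`; this many samples bring the missed proportion down to `n ^ (-2)`.
  obtain ⟨m, hm⟩ : ∃ m : ℕ, m = ⌈48 * g * ℓ / n ^ 2⌉₊ := ⟨_, rfl⟩
  obtain ⟨D, hD, hDm, hDs⟩ := exists_hitting_set hGne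
    (e := fun y => (#(Γ.fib (Γ.X \ C) y) : ℝ)) (fun y => Nat.cast_nonneg _)
    (Q := fun y => Γ.nb (Γ.fib C y)) hρ0 m (Γ.heavy C) (by
      intro y hy
      have hsub : Γ.nb (Γ.fib C y) ⊆ Γ.nb C := nb_mono (filter_subset _ _)
      rw [cast_card_sdiff hsub, hρ, sub_mul, one_mul, ← hg, div_mul_cancel₀ _ hg0.ne']
      linarith [le_card_nb_fib hC hy])
  rw [← hg] at hDs
  have hm1 : (m : ℝ) ≤ 48 * g * ℓ / n ^ 2 + 1 := hm ▸ (Nat.ceil_lt_add_one (by positivity)).le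
  have hm2 : 48 * g * ℓ / n ^ 2 ≤ m := hm ▸ Nat.le_ceil _
  clear_value n g ℓ ρ
  refine ⟨D, hD, ?_, hDs.trans ?_⟩
  · have : (#D : ℝ) ≤ m := by exact_mod_cast hDm
    linarith [sample_size_le hn hℓ1 hTn hgT]
  · have hs := sum_card_fib_sdiff_le hC
    rw [← hg, ← hT, ← hndef] at hs
    have h1 : (m : ℝ) * ((∑ y ∈ Γ.nb C, (#(Γ.fib (Γ.X \ C) y) : ℝ)) / g)
        ≤ 49 * (T * ℓ / n) := by
      calc (m : ℝ) * ((∑ y ∈ Γ.nb C, (#(Γ.fib (Γ.X \ C) y) : ℝ)) / g)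
          ≤ (48 * g * ℓ / n ^ 2 + 1) * (n * T / g) :=
            mul_le_mul hm1 (div_le_div_of_nonneg_right hs hg0.le) (by positivity)
              ((Nat.cast_nonneg m).trans hm1)
        _ ≤ _ := sample_cost_le hn hℓ1 hT0 hgn
    have h2 : ρ ^ m * (#(Γ.heavy C) : ℝ) ≤ 2 * (T * ℓ / n) := by
      have e1 : ρ ^ m ≤ 1 / n ^ 2 := hρ ▸ one_sub_pow_le hn hℓ hgn hm2
      have e2 : (#(Γ.heavy C) : ℝ) ≤ g := by
        rw [hg]; exact_mod_cast card_le_card (filter_subset _ _)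
      calc ρ ^ m * (#(Γ.heavy C) : ℝ) ≤ 1 / n ^ 2 * ((n + 1) * T) :=
            mul_le_mul e1 (e2.trans hgT) (Nat.cast_nonneg _) (by positivity)
        _ ≤ _ := sample_rest_le hn hℓ1 hT0
    linarith

end UpGraph

/-! ### Certificates encoding a first approximation -/

namespace UpGraph

variable {V : Type*} [DecidableEq V]

/-- The part of a neighbourhood reconstructed from a certificate `(D, Ω, H, U)`. -/
def certCore (Γ : UpGraph V) (D Ω H U : Finset V) : Finset V :=
  (Γ.nb ({x ∈ Γ.X | ¬ Disjoint (Γ.N x) D} \ Ω) ∪ H) ∪ Γ.nb U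

/-- The vertices almost all of whose neighbours lie in `F`. -/
noncomputable def almostInside (Γ : UpGraph V) (F : Finset V) : Finset V :=
  {x ∈ Γ.X | (#(Γ.N x \ F) : ℝ) ≤ Γ.n / 4}

/-- The upper approximation reconstructed from a certificate. -/
noncomputable def certOuter (Γ : UpGraph V) (D Ω H U W : Finset V) : Finset V :=
  {x ∈ Γ.almostInside (Γ.certCore D Ω H U) | Disjoint (Γ.N x) W}

/-- The lower approximation reconstructed from a certificate. -/
noncomputable def certInner (Γ : UpGraph V) (D Ω H U W : Finset V) : Finset V :=
  Γ.certCore D Ω H U ∪ {y ∈ Γ.nb (Γ.certOuter D Ω H U W) |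
    (Γ.n : ℝ) / 4 < #(Γ.fib (Γ.certOuter D Ω H U W) y)}

variable {Γ : UpGraph V}

/-- Every closed set `C` has a small certificate near `C` that reconstructs an approximation. -/
lemma exists_certificate {C : Finset V} (hC : Γ.IsClosedSet C) {T : ℝ}
    (hT : T = (#(Γ.nb C) : ℝ) - #C) (hCT : (#C : ℝ) ≤ Γ.n * T) (hG : Γ.n ^ 2 ≤ #(Γ.nb C))
    (hTn : (Γ.n : ℝ) ^ 2 ≤ 96 * T) :
    ∃ D Ω H U W Z : Finset V, Z = D ∪ Ω ∪ H ∪ U ∪ W ∧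
      Γ.IsApprox (Γ.n / 4) (Γ.certInner D Ω H U W) (Γ.certOuter D Ω H U W) ∧
      Γ.certInner D Ω H U W ⊆ Γ.nb C ∧ C ⊆ Γ.certOuter D Ω H U W ∧
      (#Z : ℝ) ≤ 170 * (T * Real.log Γ.n / Γ.n) ∧
      (∀ x ∈ C, ∃ z ∈ Z, Γ.dist x z ≤ 3) ∧ (∀ z ∈ Z, ∃ x ∈ C, Γ.dist x z ≤ 3) := by
  have hn := Γ.three_le_n
  have hn0 := Γ.n_pos
  have hn4 : (0 : ℝ) ≤ Γ.n / 4 := by positivity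
  obtain ⟨D, hDC, hDcard, hDcost⟩ := exists_dominating hC.1 hT hCT hG hTn
  -- The neighbours of `D` in `X` can be read off from `D`; listing those outside `C` reveals those
  -- inside `C` without knowledge of `C`. There are few, by the cost bound on `D`.
  obtain ⟨Ω, hΩ⟩ : ∃ Ω, Ω = {x ∈ Γ.X \ C | ¬ Disjoint (Γ.N x) D} := ⟨_, rfl⟩
  obtain ⟨H, hH⟩ : ∃ H, H = {y ∈ Γ.heavy C | Disjoint D (Γ.nb (Γ.fib C y))} := ⟨_, rfl⟩
  obtain ⟨F', hF'⟩ : ∃ F', F' = Γ.nb ({x ∈ Γ.X | ¬ Disjoint (Γ.N x) D} \ Ω) ∪ H := ⟨_, rfl⟩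
  have hcore : {x ∈ Γ.X | ¬ Disjoint (Γ.N x) D} \ Ω = {x ∈ C | ¬ Disjoint (Γ.N x) D} := by
    ext x
    simp only [hΩ, mem_sdiff, mem_filter]
    constructor
    · tauto
    · rintro ⟨h1, h2⟩
      exact ⟨⟨hC.1 h1, h2⟩, fun h => h.1.2 h1⟩
  have hHheavy : H ⊆ Γ.heavy C := hH ▸ filter_subset _ _
  have hHC : H ⊆ Γ.nb C := hHheavy.trans (filter_subset _ _)
  have hF'C : F' ⊆ Γ.nb C := by
    rw [hF', hcore]
    exact union_subset (nb_mono (filter_subset _ _)) hHC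
  have hheavy : Γ.heavy C ⊆ F' := by
    intro y hy
    rw [hF', hcore, mem_union]
    by_cases hd : Disjoint D (Γ.nb (Γ.fib C y))
    · exact Or.inr (hH ▸ mem_filter.2 ⟨hy, hd⟩)
    · left
      obtain ⟨z, hzD, hz⟩ := not_disjoint_iff.1 hd
      obtain ⟨x, hx, hzx⟩ := mem_nb.1 hz
      rw [mem_fib] at hx
      exact mem_nb.2 ⟨x, mem_filter.2 ⟨hx.1, not_disjoint_iff.2 ⟨z, hzx, hzD⟩⟩, hx.2⟩
  obtain ⟨U, hUC, hU, hUcard⟩ := exists_greedy_cover C Γ.N F' hn4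
  have hF1 : Γ.certCore D Ω H U = F' ∪ Γ.nb U := by rw [hF']; rfl
  have hF1C : Γ.certCore D Ω H U ⊆ Γ.nb C := by
    rw [hF1]; exact union_subset hF'C (nb_mono hUC)
  obtain ⟨S₁, hS₁⟩ : ∃ S₁, S₁ = Γ.almostInside (Γ.certCore D Ω H U) := ⟨_, rfl⟩
  have hS₁X : S₁ ⊆ Γ.X := hS₁ ▸ filter_subset _ _
  have hS₁low : ∀ x ∈ S₁, (#(Γ.N x \ Γ.certCore D Ω H U) : ℝ) ≤ Γ.n / 4 := fun x hx =>
    (mem_filter.1 (hS₁ ▸ hx : x ∈ Γ.almostInside (Γ.certCore D Ω H U))).2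
  have hCS₁ : C ⊆ S₁ := by
    intro x hx
    rw [hS₁]
    refine mem_filter.2 ⟨hC.1 hx, ?_⟩
    rw [hF1]
    exact hU x hx
  have hS₁card := card_sdiff_le hS₁X hCS₁ hF1C le_rfl hS₁low
  rw [← hT] at hS₁card
  -- The greedy cover is now applied from the other side. As `W` avoids `nb C`, deleting its
  -- neighbours from `S₁` removes no element of `C`, and afterwards every vertex outside `nb C` has
  -- at most `n / 4` neighbours left.
  obtain ⟨W, hWsub, hW, hWcard⟩ := exists_greedy_cover (Γ.nb S₁ \ Γ.nb C) (Γ.fib S₁) ∅ hn4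
  have hS : Γ.certOuter D Ω H U W = {x ∈ S₁ | Disjoint (Γ.N x) W} := by rw [hS₁]; rfl
  have hSS₁ : Γ.certOuter D Ω H U W ⊆ S₁ := hS ▸ filter_subset _ _
  -- An element of `S₁` has at least `n / 2` neighbours and at most `n / 4` of them outside the
  -- core. This is what keeps the certificate close to `C` and `C` close to the certificate.
  have hmeet : ∀ x ∈ S₁, ∃ y ∈ Γ.N x, y ∈ Γ.certCore D Ω H U := by
    intro x hx
    by_contra! hno
    have h1 : Γ.N x \ Γ.certCore D Ω H U = Γ.N x :=
      sdiff_eq_self_of_disjoint (disjoint_left.2 hno)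
    have h2 := hS₁low x hx
    rw [h1] at h2
    linarith [le_card_N (hS₁X hx)]
  refine ⟨D, Ω, H, U, W, _, rfl, ⟨hSS₁.trans hS₁X, ?_, ?_⟩, ?_, ?_, ?_, ?_, ?_⟩
  · intro x hx
    refine le_trans ?_ (hS₁low x (hSS₁ hx))
    exact_mod_cast card_le_card (sdiff_subset_sdiff subset_rfl subset_union_left)
  · intro y hy
    by_contra! hlt
    refine hy (mem_union_right _ (mem_filter.2 ⟨?_, hlt⟩))
    have : (0 : ℝ) < #(Γ.fib (Γ.certOuter D Ω H U W) y) := lt_of_le_of_lt hn4 hlt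
    have h0 : 0 < #(Γ.fib (Γ.certOuter D Ω H U W) y) := by exact_mod_cast this
    obtain ⟨x, hx⟩ := card_pos.1 h0
    exact mem_nb.2 ⟨x, mem_fib.1 hx⟩
  · refine union_subset hF1C fun y hy => ?_
    obtain ⟨hy1, hy2⟩ := mem_filter.1 hy
    by_contra hyC
    have h1 := hW y (mem_sdiff.2 ⟨nb_mono hSS₁ hy1, hyC⟩)
    have h2 : Γ.fib (Γ.certOuter D Ω H U W) y ⊆ Γ.fib S₁ y \ (∅ ∪ W.biUnion (Γ.fib S₁)) := by
      intro x hx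
      rw [mem_fib, hS, mem_filter] at hx
      simp only [empty_union, mem_sdiff, mem_biUnion, mem_fib, not_exists, not_and]
      exact ⟨⟨hx.1.1, hx.2⟩, fun z hz _ hzx => disjoint_left.1 hx.1.2 hzx hz⟩
    have h3 : (#(Γ.fib (Γ.certOuter D Ω H U W) y) : ℝ)
        ≤ #(Γ.fib S₁ y \ (∅ ∪ W.biUnion (Γ.fib S₁))) := by exact_mod_cast card_le_card h2
    linarith
  · intro x hx
    rw [hS, mem_filter]
    exact ⟨hCS₁ hx, disjoint_left.2 fun y hy hyW =>
      (mem_sdiff.1 (hWsub hyW)).2 (N_subset_nb hx hy)⟩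
  · have hℓ1 : 1 ≤ Real.log Γ.n := by
      rw [Real.le_log_iff_exp_le hn0]
      exact (Real.exp_one_lt_d9.le.trans (by norm_num)).trans hn
    have hT0 : 0 < T := by nlinarith
    have hTn : T / Γ.n ≤ T * Real.log Γ.n / Γ.n :=
      div_le_div_of_nonneg_right (le_mul_of_one_le_right hT0.le hℓ1) hn0.le
    have h1 : (#Ω : ℝ) ≤ ∑ y ∈ D, (#(Γ.fib (Γ.X \ C) y) : ℝ) := by
      have : Ω ⊆ D.biUnion (Γ.fib (Γ.X \ C)) := by
        intro x hx
        rw [hΩ, mem_filter] at hx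
        obtain ⟨z, hzx, hzD⟩ := not_disjoint_iff.1 hx.2
        exact mem_biUnion.2 ⟨z, hzD, mem_fib.2 ⟨hx.1, hzx⟩⟩
      exact_mod_cast (card_le_card this).trans card_biUnion_le
    have h2 : (#U : ℝ) ≤ 8 * (T / Γ.n) := by
      have h3 : (#(Γ.nb C \ F') : ℝ) ≤ #(Γ.nb C \ Γ.heavy C) := by
        exact_mod_cast card_le_card (sdiff_subset_sdiff subset_rfl hheavy)
      have h4 := card_nb_sdiff_heavy_le hC.1
      rw [← hT] at h4
      have h5 : (Γ.n : ℝ) / 4 * #U ≤ 2 * T := hUcard.trans (h3.trans h4)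
      rw [← mul_div_assoc, le_div_iff₀ hn0]
      linarith
    have h3 : (#W : ℝ) ≤ 8 * (T / Γ.n) := by
      have h4 : (#((Γ.nb S₁ \ Γ.nb C).biUnion (Γ.fib S₁) \ ∅) : ℝ) ≤ #(S₁ \ C) := by
        refine Nat.cast_le.2 (card_le_card fun x hx => ?_)
        simp only [sdiff_empty, mem_biUnion, mem_sdiff, mem_fib] at hx ⊢
        obtain ⟨y, ⟨_, hyC⟩, hxS, hyx⟩ := hx
        exact ⟨hxS, fun hxC => hyC (N_subset_nb hxC hyx)⟩
      have h5 : (Γ.n : ℝ) / 4 * #W ≤ 2 * T := hWcard.trans (h4.trans hS₁card)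
      rw [← mul_div_assoc, le_div_iff₀ hn0]
      linarith
    have h4 : (#(D ∪ Ω ∪ H ∪ U ∪ W) : ℝ) ≤ #D + #Ω + #H + #U + #W := by
      have a1 := card_union_le (D ∪ Ω ∪ H ∪ U) W
      have a2 := card_union_le (D ∪ Ω ∪ H) U
      have a3 := card_union_le (D ∪ Ω) H
      have a4 := card_union_le D Ω
      exact_mod_cast (by omega :
        #(D ∪ Ω ∪ H ∪ U ∪ W) ≤ #D + #Ω + #H + #U + #W)
    rw [← hH] at hDcost
    have hpos : 0 ≤ T / Γ.n := by positivity
    -- In units of `T log n / n` the total is at most 96 for `D`, 51 for `Ω` and `H` together, and 8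
    -- for each of `U` and `W`.
    linarith
  · intro x hx
    obtain ⟨y, hyx, hy⟩ := hmeet x (hCS₁ hx)
    have hxy := Γ.dist_le_one x y hyx
    rw [hF1, hF', hcore, mem_union, mem_union] at hy
    rcases hy with (hy | hy) | hy
    · obtain ⟨v, hv, hyv⟩ := mem_nb.1 hy
      obtain ⟨z, hzv, hz⟩ := not_disjoint_iff.1 (mem_filter.1 hv).2
      refine ⟨z, by simp [hz], ?_⟩
      have h1 := Γ.dist_triangle x y z
      have h2 := Γ.dist_triangle y v z
      have h3 := Γ.dist_le_one v y hyv
      have h4 := Γ.dist_le_one v z hzv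
      rw [Γ.dist_comm] at h3
      omega
    · exact ⟨y, by simp [hy], by omega⟩
    · obtain ⟨v, hv, hyv⟩ := mem_nb.1 hy
      refine ⟨v, by simp [hv], ?_⟩
      have h1 := Γ.dist_triangle x y v
      have h3 := Γ.dist_le_one v y hyv
      rw [Γ.dist_comm] at h3
      omega
  · have hnear : ∀ y ∈ Γ.nb C, ∃ x ∈ C, Γ.dist x y ≤ 1 := by
      intro y hy
      obtain ⟨x, hx, hxy⟩ := mem_nb.1 hy
      exact ⟨x, hx, Γ.dist_le_one x y hxy⟩
    intro z hz
    simp only [mem_union] at hz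
    rcases hz with (((hz | hz) | hz) | hz) | hz
    · obtain ⟨x, hx, hd⟩ := hnear z (hDC hz)
      exact ⟨x, hx, by omega⟩
    · rw [hΩ, mem_filter] at hz
      obtain ⟨y, hyz, hyD⟩ := not_disjoint_iff.1 hz.2
      obtain ⟨x, hx, hd⟩ := hnear y (hDC hyD)
      refine ⟨x, hx, ?_⟩
      have h1 := Γ.dist_triangle x y z
      have h2 := Γ.dist_le_one z y hyz
      rw [Γ.dist_comm] at h2
      omega
    · obtain ⟨x, hx, hd⟩ := hnear z (hHC hz)
      exact ⟨x, hx, by omega⟩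
    · exact ⟨z, hUC hz, by rw [Γ.dist_self]; omega⟩
    · obtain ⟨v, hv, hzv⟩ := mem_nb.1 (mem_sdiff.1 (hWsub hz)).1
      obtain ⟨y, hyv, hy⟩ := hmeet v hv
      obtain ⟨x, hx, hd⟩ := hnear y (hF1C hy)
      refine ⟨x, hx, ?_⟩
      have h1 := Γ.dist_triangle x y z
      have h2 := Γ.dist_triangle y v z
      have h3 := Γ.dist_le_one v y hyv
      have h4 := Γ.dist_le_one v z hzv
      rw [Γ.dist_comm] at h3
      omega

end UpGraph

/-! ### Union bounds and the number of small subsets -/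

/-- A union bound for weighted sums. -/
lemma sum_le_card_mul_of_cover {ι κ : Type*} {P : Finset ι} {Z : Finset κ} {W : ι → ℝ}
    (hW : ∀ p ∈ P, 0 ≤ W p) (r : ι → κ → Prop) [∀ p z, Decidable (r p z)]
    (hcover : ∀ p ∈ P, ∃ z ∈ Z, r p z) {B : ℝ} (hB : ∀ z ∈ Z, ∑ p ∈ P with r p z, W p ≤ B) :
    ∑ p ∈ P, W p ≤ #Z * B := by
  rw [← nsmul_eq_mul]
  refine le_trans ?_ (sum_le_card_nsmul Z (fun z => ∑ p ∈ P with r p z, W p) B hB)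
  simp only [sum_filter]
  rw [sum_comm]
  refine sum_le_sum fun p hp => ?_
  obtain ⟨z, hz, hr⟩ := hcover p hp
  refine le_trans ?_ (single_le_sum (f := fun z => if r p z then W p else 0) (fun z _ => ?_) hz)
  · simp [hr]
  · split_ifs
    exacts [hW p hp, le_rfl]

/-- The number of subsets with at most `k` elements. -/
lemma card_small_subsets_le {V : Type*} (S : Finset V) (k : ℝ) {p : ℝ} (hp : 0 ≤ p) :
    (#{U ∈ S.powerset | (#U : ℝ) ≤ k} : ℝ) ≤ Real.exp (p * k + Real.exp (-p) * #S) := by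
  classical
  -- Exponential moment bound: each small `U` has `exp (p (k - #U)) ≥ 1`, and summing over all
  -- subsets gives a binomial power.
  have h1 : (#{U ∈ S.powerset | (#U : ℝ) ≤ k} : ℝ)
      ≤ ∑ U ∈ S.powerset, Real.exp (p * k) * Real.exp (-p) ^ #U := by
    rw [← mul_one (#{U ∈ S.powerset | (#U : ℝ) ≤ k} : ℝ), ← nsmul_eq_mul]
    refine le_trans (card_nsmul_le_sum _ (fun U => Real.exp (p * k) * Real.exp (-p) ^ #U) 1 ?_)
      (sum_le_sum_of_subset_of_nonneg (filter_subset _ _) fun U _ _ => by positivity)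
    intro U hU
    have hk := (mem_filter.1 hU).2
    rw [← Real.exp_nat_mul, ← Real.exp_add, Real.one_le_exp_iff]
    nlinarith
  refine h1.trans ?_
  have h2 := sum_pow_mul_eq_add_pow (Real.exp (-p)) 1 S
  simp only [one_pow, mul_one] at h2
  rw [← mul_sum, h2, Real.exp_add]
  refine mul_le_mul_of_nonneg_left ?_ (Real.exp_pos _).le
  rw [mul_comm, Real.exp_nat_mul]
  exact pow_le_pow_left₀ (by positivity) (Real.add_one_le_exp _) _

/-! ### Weighted families of closed sets and refinement of the scale -/

namespace UpGraph

variable {V : Type*} [DecidableEq V]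

/-- A weighted family of closed sets of prescribed size and excess `T`, in which the total weight
inside any given set `S` is under control. -/
structure ClosedFamily (Γ : UpGraph V) (ι : Type*) where
  /-- the index set -/
  P : Finset ι
  /-- the closed sets -/
  C : ι → Finset V
  /-- the weights -/
  W : ι → ℝ
  /-- the size of the closed sets -/
  c : ℕ
  /-- the size of their neighbourhoods -/
  g : ℕ
  /-- the excess -/
  T : ℝ
  /-- the normalization of the weights -/
  h : ℝ
  /-- the logarithmic weight per element -/
  Λ : ℝ
  W_nonneg : ∀ p ∈ P, 0 ≤ W p
  closed : ∀ p ∈ P, Γ.IsClosedSet (C p)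
  card_C : ∀ p ∈ P, #(C p) = c
  card_nb : ∀ p ∈ P, #(Γ.nb (C p)) = g
  T_eq : T = g - c
  c_le : (c : ℝ) ≤ Γ.n * T
  le_g : Γ.n ^ 2 ≤ g
  le_T : (Γ.n : ℝ) ^ 2 ≤ 96 * T
  le_Λ : 30000 * (Real.log Γ.n ^ 2 / √Γ.n) ≤ Λ
  sum_le : ∀ S ⊆ Γ.X, ∑ p ∈ P with C p ⊆ S, W p ≤ Real.exp (Λ * (#S - h))

namespace ClosedFamily

variable {Γ : UpGraph V} {ι : Type*} (𝓕 : Γ.ClosedFamily ι)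

/-- The members of the family approximated by `(F, S)`. -/
def between (F S : Finset V) : Finset ι := {p ∈ 𝓕.P | F ⊆ Γ.nb (𝓕.C p) ∧ 𝓕.C p ⊆ S}

variable {𝓕}

lemma mem_between {F S : Finset V} {p : ι} :
    p ∈ 𝓕.between F S ↔ p ∈ 𝓕.P ∧ F ⊆ Γ.nb (𝓕.C p) ∧ 𝓕.C p ⊆ S := mem_filter

lemma T_pos : 0 < 𝓕.T := by
  have h1 := 𝓕.le_T
  have h2 : (0 : ℝ) < (Γ.n : ℝ) ^ 2 := pow_pos Γ.n_pos 2
  linarith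

lemma excess {p : ι} (hp : p ∈ 𝓕.P) : (#(Γ.nb (𝓕.C p)) : ℝ) - #(𝓕.C p) = 𝓕.T := by
  rw [𝓕.card_C p hp, 𝓕.card_nb p hp, 𝓕.T_eq]

lemma one_le_log : 1 ≤ Real.log Γ.n := by
  rw [Real.le_log_iff_exp_le Γ.n_pos]
  exact (Real.exp_one_lt_d9.le.trans (by norm_num)).trans Γ.three_le_n

lemma Λ_nonneg : 0 ≤ 𝓕.Λ := le_trans (by positivity) 𝓕.le_Λ

lemma sum_between_le {F S : Finset V} (hS : S ⊆ Γ.X) :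
    ∑ p ∈ 𝓕.between F S, 𝓕.W p ≤ Real.exp (𝓕.Λ * (#S - 𝓕.h)) := by
  refine le_trans ?_ (𝓕.sum_le S hS)
  refine sum_le_sum_of_subset_of_nonneg ?_ fun p hp _ => 𝓕.W_nonneg p (mem_filter.1 hp).1
  intro p hp
  rw [mem_between] at hp
  exact mem_filter.2 ⟨hp.1, hp.2.2⟩

/-- A crude bound, needed only to count small subsets of `S` and `nb S`: polynomial factors in `n`
there cost only a logarithm. -/
lemma card_outer_le {ψ : ℝ} {F S : Finset V} (hA : Γ.IsApprox ψ F S) (hψ : ψ ≤ Γ.n / 4)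
    {p : ι} (hp : p ∈ 𝓕.between F S) : (#S : ℝ) ≤ 2 * Γ.n * 𝓕.T := by
  rw [mem_between] at hp
  have h1 := card_sdiff_le hA.subset hp.2.2 hp.2.1 hψ hA.lower
  rw [excess hp.1, cast_card_sdiff hp.2.2, 𝓕.card_C p hp.1] at h1
  have h2 := 𝓕.c_le
  have h3 := Γ.three_le_n
  have h4 := 𝓕.T_pos
  nlinarith

/-- The case in which the lower approximation is far from the neighbourhoods. -/
lemma sum_between_le_of_far {ψ : ℝ} {F S : Finset V} (hA : Γ.IsApprox ψ F S)
    (hψ : ψ ≤ Γ.n / 4) (hψ0 : √Γ.n / 4 ≤ ψ)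
    (hfar : 16 * ψ * 𝓕.T / Γ.n ≤ 𝓕.g - #F) :
    ∑ p ∈ 𝓕.between F S, 𝓕.W p ≤ Real.exp (𝓕.Λ * (𝓕.g - 𝓕.T / √Γ.n - 𝓕.h)) := by
  rcases (𝓕.between F S).eq_empty_or_nonempty with he | ⟨p, hp⟩
  · rw [he, sum_empty]; positivity
  · refine (sum_between_le hA.subset).trans ?_
    rw [Real.exp_le_exp]
    refine mul_le_mul_of_nonneg_left ?_ 𝓕.Λ_nonneg
    rw [mem_between] at hp
    have hψ1 : 0 ≤ ψ := le_trans (by positivity) hψ0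
    -- With `x = 4ψT / n` the bound reads `#S ≤ g - (g - #F) / 2 + x`. Being far means `g - #F ≥
    -- 4x`, hence `#S ≤ g - x`, and `x ≥ T / √n` since `ψ ≥ √n / 4`.
    have h1 := hA.card_le hp.2.2 hp.2.1 hψ hψ1
    rw [excess hp.1, cast_card_sdiff hp.2.1, 𝓕.card_nb p hp.1] at h1
    have h2 : 𝓕.T / √Γ.n ≤ 4 * ψ / Γ.n * 𝓕.T := by
      have hs : 0 < √(Γ.n : ℝ) := Real.sqrt_pos.2 Γ.n_pos
      have hss : √(Γ.n : ℝ) * √Γ.n = Γ.n := Real.mul_self_sqrt Γ.n_pos.le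
      rw [div_mul_eq_mul_div, div_le_div_iff₀ hs Γ.n_pos]
      have h3 : (Γ.n : ℝ) ≤ 4 * ψ * √Γ.n := by nlinarith
      nlinarith [𝓕.T_pos]
    have e : 16 * ψ * 𝓕.T / Γ.n = 4 * (4 * ψ / Γ.n * 𝓕.T) := by ring
    linarith

/-- The case in which the neighbourhoods are determined by few further vertices. -/
lemma sum_between_le_of_near {ψ M : ℝ} {F S : Finset V} (hA : Γ.IsApprox ψ F S)
    (hψ : ψ ≤ Γ.n / 4) (hnear : 𝓕.g - #F ≤ M) :
    ∑ p ∈ 𝓕.between F S, 𝓕.W p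
      ≤ Real.exp (3 * Real.log Γ.n * M + 2 * 𝓕.T / Γ.n) *
        Real.exp (𝓕.Λ * (𝓕.c - 𝓕.h)) := by
  have hn0 := Γ.n_pos
  rcases (𝓕.between F S).eq_empty_or_nonempty with he | ⟨p₀, hp₀⟩
  · rw [he, sum_empty]; positivity
  have hScard := card_outer_le hA hψ hp₀
  -- The choice `exp (-p) = n ^ (-3)` compensates `#(nb S) ≤ 2 n² T`.
  have hcount := card_small_subsets_le (Γ.nb S) M (p := 3 * Real.log Γ.n)
    (by linarith [one_le_log (Γ := Γ)])
  have hexp : Real.exp (-(3 * Real.log Γ.n)) * #(Γ.nb S) ≤ 2 * 𝓕.T / Γ.n := by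
    have e : Real.exp (-(3 * Real.log Γ.n)) = 1 / (Γ.n : ℝ) ^ 3 := by
      rw [Real.exp_neg, mul_comm, Real.exp_mul, Real.exp_log hn0, one_div]
      norm_cast
    rw [e, one_div_mul_eq_div, div_le_div_iff₀ (by positivity) hn0]
    have h1 := card_nb_le hA.subset
    calc (#(Γ.nb S) : ℝ) * Γ.n ≤ (Γ.n * (2 * Γ.n * 𝓕.T)) * Γ.n := by
          refine mul_le_mul_of_nonneg_right (h1.trans ?_) hn0.le
          exact mul_le_mul_of_nonneg_left hScard hn0.le
      _ = _ := by ring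
  refine (sum_le_card_mul_of_cover (Z := {R ∈ (Γ.nb S).powerset | (#R : ℝ) ≤ M})
    (fun p hp => 𝓕.W_nonneg p (mem_between.1 hp).1) (fun p R => Γ.nb (𝓕.C p) \ F = R) ?_
    (B := Real.exp (𝓕.Λ * (𝓕.c - 𝓕.h))) ?_).trans ?_
  · intro p hp
    rw [mem_between] at hp
    refine ⟨_, mem_filter.2 ⟨mem_powerset.2 (sdiff_subset.trans (nb_mono hp.2.2)), ?_⟩, rfl⟩
    rw [cast_card_sdiff hp.2.1, 𝓕.card_nb p hp.1]
    exact hnear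
  · intro R _
    rcases (filter (fun p => Γ.nb (𝓕.C p) \ F = R) (𝓕.between F S)).eq_empty_or_nonempty
      with he | ⟨q, hq⟩
    · rw [he, sum_empty]; positivity
    -- Closed sets with the same neighbourhood contain one another, so `C q` serves as a container
    -- for the whole class; its size is only `c = g - T`.
    · rw [mem_filter, mem_between] at hq
      have h1 := 𝓕.sum_le (𝓕.C q) (𝓕.closed q hq.1.1).1
      rw [𝓕.card_C q hq.1.1] at h1
      refine le_trans ?_ h1
      refine sum_le_sum_of_subset_of_nonneg ?_ fun p hp _ => 𝓕.W_nonneg p (mem_filter.1 hp).1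
      intro p hp
      rw [mem_filter, mem_between] at hp
      refine mem_filter.2 ⟨hp.1.1, fun x hx => ?_⟩
      refine (𝓕.closed q hq.1.1).2 x ((𝓕.closed p hp.1.1).1 hx) ?_
      refine (N_subset_nb hx).trans ?_
      rw [← union_sdiff_of_subset hp.1.2.1, hp.2, ← hq.2, union_sdiff_of_subset hq.1.2.1]
  · refine mul_le_mul_of_nonneg_right (hcount.trans ?_) (Real.exp_pos _).le
    rw [Real.exp_le_exp]
    linarith

/-- Passing to half the scale. -/
lemma sum_between_le_of_halve {ψ B : ℝ} {F S : Finset V} (hA : Γ.IsApprox ψ F S)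
    (hψ : ψ ≤ Γ.n / 4) (hψ0 : 0 < ψ) (hnear : 𝓕.g - #F ≤ 16 * ψ * 𝓕.T / Γ.n)
    (hB : ∀ F' S', Γ.IsApprox (ψ / 2) F' S' → ∑ p ∈ 𝓕.between F' S', 𝓕.W p ≤ B) :
    ∑ p ∈ 𝓕.between F S, 𝓕.W p ≤ Real.exp (66 * (𝓕.T * Real.log Γ.n / Γ.n)) * B := by
  have hn0 := Γ.n_pos
  have hℓ := one_le_log (Γ := Γ)
  have hB0 : 0 ≤ B := by
    -- Nonnegativity of `B` comes from the trivial approximation with empty upper part.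
    refine le_trans ?_ (hB F ∅ ⟨empty_subset _, by simp, fun y _ => ?_⟩)
    · exact sum_nonneg fun p hp => 𝓕.W_nonneg p (mem_between.1 hp).1
    · have : Γ.fib ∅ y = ∅ := by simp [fib]
      rw [this, card_empty, Nat.cast_zero]; positivity
  rcases (𝓕.between F S).eq_empty_or_nonempty with he | ⟨p₀, hp₀⟩
  · rw [he, sum_empty]; positivity
  have hScard := card_outer_le hA hψ hp₀
  -- A greedy cover at threshold `ψ / 2` of at most `16ψT / n` vertices uses at most `32 T / n`
  -- elements, independently of `ψ`.
  set k : ℝ := 32 * 𝓕.T / Γ.n with hk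
  have hcount := card_small_subsets_le S k (p := 2 * Real.log Γ.n) (by linarith)
  have hexp : Real.exp (-(2 * Real.log Γ.n)) * #S ≤ 2 * 𝓕.T / Γ.n := by
    have e : Real.exp (-(2 * Real.log Γ.n)) = 1 / (Γ.n : ℝ) ^ 2 := by
      rw [Real.exp_neg, mul_comm, Real.exp_mul, Real.exp_log hn0, one_div]
      norm_cast
    rw [e, one_div_mul_eq_div, div_le_div_iff₀ (by positivity) hn0]
    calc (#S : ℝ) * Γ.n ≤ (2 * Γ.n * 𝓕.T) * Γ.n :=
          mul_le_mul_of_nonneg_right hScard hn0.le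
      _ = _ := by ring
  refine (sum_le_card_mul_of_cover (Z := {U ∈ S.powerset | (#U : ℝ) ≤ k})
    (fun p hp => 𝓕.W_nonneg p (mem_between.1 hp).1)
    (fun p U => U ⊆ 𝓕.C p ∧ ∀ x ∈ 𝓕.C p, (#(Γ.N x \ (F ∪ Γ.nb U)) : ℝ) ≤ ψ / 2) ?_
    (B := B) ?_).trans ?_
  · intro p hp
    rw [mem_between] at hp
    obtain ⟨U, hUC, hU, hUcard⟩ := exists_greedy_cover (𝓕.C p) Γ.N F
      (by positivity : 0 ≤ ψ / 2)
    refine ⟨U, mem_filter.2 ⟨mem_powerset.2 (hUC.trans hp.2.2), ?_⟩, hUC, hU⟩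
    have h1 : (#((𝓕.C p).biUnion Γ.N \ F) : ℝ) = 𝓕.g - #F := by
      rw [← 𝓕.card_nb p hp.1]; exact cast_card_sdiff hp.2.1
    rw [h1] at hUcard
    have h2 : ψ / 2 * #U ≤ ψ / 2 * k := by
      refine (hUcard.trans hnear).trans (le_of_eq ?_)
      rw [hk]; ring
    exact le_of_mul_le_mul_left h2 (by positivity)
  · intro U _
    -- Enlarging `F` and shrinking `S` preserves the bound `n / 4` on the upper side, so only the
    -- lower condition has to be improved.
    refine le_trans ?_ (hB (F ∪ Γ.nb U) {x ∈ S | (#(Γ.N x \ (F ∪ Γ.nb U)) : ℝ) ≤ ψ / 2}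
      ⟨(filter_subset _ _).trans hA.subset, fun x hx => (mem_filter.1 hx).2, fun y hy => ?_⟩)
    · refine sum_le_sum_of_subset_of_nonneg ?_ fun p hp _ => 𝓕.W_nonneg p (mem_between.1 hp).1
      intro p hp
      rw [mem_filter, mem_between] at hp
      rw [mem_between]
      exact ⟨hp.1.1, union_subset hp.1.2.1 (nb_mono hp.2.1),
        fun x hx => mem_filter.2 ⟨hp.1.2.2 hx, hp.2.2 x hx⟩⟩
    · refine le_trans ?_ (hA.upper y fun h => hy (mem_union_left _ h))
      exact_mod_cast card_le_card (fib_mono (filter_subset _ _) y)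
  · refine mul_le_mul_of_nonneg_right (hcount.trans ?_) hB0
    rw [Real.exp_le_exp]
    have h1 : 2 * Real.log Γ.n * k = 64 * (𝓕.T * Real.log Γ.n / Γ.n) := by rw [hk]; ring
    have h2 : 2 * 𝓕.T / Γ.n ≤ 2 * (𝓕.T * Real.log Γ.n / Γ.n) := by
      rw [mul_div_assoc]
      have := le_mul_of_one_le_right 𝓕.T_pos.le hℓ
      gcongr
    linarith

lemma sqrt_le_log_mul : 125 * (Real.log Γ.n / √Γ.n) ≤ 𝓕.Λ := by
  refine le_trans ?_ 𝓕.le_Λ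
  have hℓ := one_le_log (Γ := Γ)
  have : Real.log Γ.n / √Γ.n ≤ Real.log Γ.n ^ 2 / √Γ.n := by
    gcongr
    nlinarith
  have h0 : 0 ≤ Real.log Γ.n / √Γ.n := by positivity
  linarith

/-- The two terminal cases combined. -/
lemma sum_between_le_of_small {ψ : ℝ} {F S : Finset V} (hA : Γ.IsApprox ψ F S)
    (hψ : ψ ≤ Γ.n / 4) (hψ0 : √Γ.n / 4 ≤ ψ) (hψ1 : ψ ≤ √Γ.n) :
    ∑ p ∈ 𝓕.between F S, 𝓕.W p ≤ Real.exp (𝓕.Λ * (𝓕.g - 𝓕.T / √Γ.n - 𝓕.h)) := by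
  rcases le_or_gt (16 * ψ * 𝓕.T / Γ.n) (𝓕.g - #F) with hfar | hnear
  · exact sum_between_le_of_far hA hψ hψ0 hfar
  have hn0 := Γ.n_pos
  have hT0 := 𝓕.T_pos
  have hℓ := one_le_log (Γ := Γ)
  have hs : 0 < √(Γ.n : ℝ) := Real.sqrt_pos.2 hn0
  have hss : √(Γ.n : ℝ) * √Γ.n = Γ.n := Real.mul_self_sqrt hn0.le
  have hs3 : (5 / 3 : ℝ) ≤ √Γ.n := by
    rw [Real.le_sqrt' (by norm_num)]
    exact le_trans (by norm_num) Γ.three_le_n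
  have hM : 𝓕.g - #F ≤ 16 * (𝓕.T / √Γ.n) := by
    refine hnear.le.trans ?_
    rw [← mul_div_assoc, div_le_div_iff₀ hn0 hs]
    have : ψ * √Γ.n ≤ Γ.n := by nlinarith
    nlinarith
  refine (sum_between_le_of_near hA hψ hM).trans ?_
  rw [← Real.exp_add, Real.exp_le_exp]
  have hc : (𝓕.c : ℝ) = 𝓕.g - 𝓕.T := by rw [𝓕.T_eq]; ring
  have h1 : 2 * 𝓕.T / Γ.n ≤ 2 * Real.log Γ.n * (𝓕.T / √Γ.n) := by
    rw [mul_div_assoc, mul_assoc]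
    have h2 : 𝓕.T / Γ.n ≤ 𝓕.T / √Γ.n := by
      gcongr
      nlinarith
    have h3 : 𝓕.T / √Γ.n ≤ Real.log Γ.n * (𝓕.T / √Γ.n) :=
      le_mul_of_one_le_left (by positivity) hℓ
    linarith
  have h2 : 𝓕.T / √Γ.n ≤ 3 / 5 * 𝓕.T := by
    rw [div_le_iff₀ hs]
    nlinarith
  -- Listing `nb C \ F` costs at most `50 T log n / √n` in the exponent. The container `C` has size
  -- `g - T` where `g - T / √n` is allowed, and `√n ≥ 5 / 3` leaves at least `2T / 5` of slack.
  have h3 : 50 * (Real.log Γ.n / √Γ.n) * 𝓕.T ≤ 𝓕.Λ * (2 / 5 * 𝓕.T) := by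
    have := mul_le_mul_of_nonneg_right (𝓕.sqrt_le_log_mul) hT0.le
    linarith
  have h4 : 𝓕.Λ * (2 / 5 * 𝓕.T) ≤ 𝓕.Λ * (𝓕.T - 𝓕.T / √Γ.n) :=
    mul_le_mul_of_nonneg_left (by linarith) 𝓕.Λ_nonneg
  have h5 : 3 * Real.log Γ.n * (16 * (𝓕.T / √Γ.n)) + 2 * Real.log Γ.n * (𝓕.T / √Γ.n)
      = 50 * (Real.log Γ.n / √Γ.n) * 𝓕.T := by ring
  have h6 : 𝓕.Λ * (𝓕.c - 𝓕.h) + 𝓕.Λ * (𝓕.T - 𝓕.T / √Γ.n)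
      = 𝓕.Λ * (𝓕.g - 𝓕.T / √Γ.n - 𝓕.h) := by rw [hc]; ring
  linarith

/-- Iterating over dyadic scales. -/
lemma sum_between_le_pow (k : ℕ) : ∀ {ψ : ℝ} {F S : Finset V}, Γ.IsApprox ψ F S →
    ψ ≤ Γ.n / 4 → √Γ.n / 4 ≤ ψ → ψ ≤ 2 ^ k * √Γ.n →
    ∑ p ∈ 𝓕.between F S, 𝓕.W p ≤ Real.exp (66 * (𝓕.T * Real.log Γ.n / Γ.n)) ^ k *
      Real.exp (𝓕.Λ * (𝓕.g - 𝓕.T / √Γ.n - 𝓕.h)) := by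
  have hT0 := 𝓕.T_pos
  have hℓ := one_le_log (Γ := Γ)
  have hq : 1 ≤ Real.exp (66 * (𝓕.T * Real.log Γ.n / Γ.n)) := by
    rw [Real.one_le_exp_iff]
    have := Γ.n_pos
    positivity
  induction k with
  | zero =>
    intro ψ F S hA hψ hψ0 hψ1
    rw [pow_zero, one_mul]
    exact sum_between_le_of_small hA hψ hψ0 (by simpa using hψ1)
  | succ k ih =>
    intro ψ F S hA hψ hψ0 hψ1
    have hone := le_mul_of_one_le_left
      (Real.exp_pos (𝓕.Λ * (𝓕.g - 𝓕.T / √Γ.n - 𝓕.h))).le (one_le_pow₀ hq (n := k + 1))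
    rcases le_or_gt (16 * ψ * 𝓕.T / Γ.n) (𝓕.g - #F) with hfar | hnear
    · exact (sum_between_le_of_far hA hψ hψ0 hfar).trans hone
    rcases le_or_gt ψ √Γ.n with hsmall | hlarge
    · exact (sum_between_le_of_small hA hψ hψ0 hsmall).trans hone
    have hs : 0 < √(Γ.n : ℝ) := Real.sqrt_pos.2 Γ.n_pos
    rw [pow_succ', mul_assoc]
    refine sum_between_le_of_halve hA hψ (by linarith) hnear.le fun F' S' hA' => ?_
    refine ih hA' (by linarith) (by linarith) ?_
    rw [pow_succ] at hψ1
    linarith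

end ClosedFamily

end UpGraph

/-! ### Counting linked sets by walks -/

section Walks

variable {V : Type*} [DecidableEq V]

/-- A finite set `Z` is linked by `R` if `R` joins every proper nonempty part of `Z` to the rest. -/
def IsLinkedBy (R : V → V → Prop) (Z : Finset V) : Prop :=
  ∀ Z₁ ⊆ Z, Z₁.Nonempty → Z₁ ≠ Z → ∃ u ∈ Z₁, ∃ v ∈ Z \ Z₁, R u v

/-- A walk through `j + 1` vertices is extended to a new vertex `v` by replacing one occurrence of
some `u` by the detour `u, v, u`, so each new vertex costs two steps. -/
lemma IsLinkedBy.exists_chain {R : V → V → Prop} (hsymm : ∀ x y, R x y → R y x) {Z : Finset V}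
    (hZ : IsLinkedBy R Z) (hne : Z.Nonempty) (j : ℕ) (hj : j + 1 ≤ #Z) :
    ∃ l : List V, l.IsChain R ∧ l.toFinset ⊆ Z ∧ #l.toFinset = j + 1 ∧ l.length = 2 * j + 1 := by
  induction j with
  | zero =>
    obtain ⟨z, hz⟩ := hne
    exact ⟨[z], by simp, by simpa using hz, by simp, by simp⟩
  | succ j ih =>
    obtain ⟨l, hl, hlZ, hcard, hlen⟩ := ih (by omega)
    obtain ⟨u, hu, v, hv, huv⟩ := hZ l.toFinset hlZ (card_pos.1 (by omega))
      (fun h => by rw [h] at hcard; omega)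
    rw [mem_sdiff] at hv
    obtain ⟨s, t, rfl⟩ := List.append_of_mem (List.mem_toFinset.1 hu)
    have hfin : (s ++ u :: v :: u :: t).toFinset = insert v (s ++ u :: t).toFinset := by
      ext x
      simp only [List.mem_toFinset, List.mem_append, List.mem_cons, mem_insert]
      tauto
    refine ⟨s ++ u :: v :: u :: t, ?_, ?_, ?_, ?_⟩
    · rw [List.isChain_append] at hl ⊢
      refine ⟨hl.1, ?_, ?_⟩
      · rw [List.isChain_cons_cons, List.isChain_cons_cons]
        exact ⟨huv, hsymm _ _ huv, hl.2.1⟩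
      · simpa using hl.2.2
    · rw [hfin]
      exact insert_subset hv.1 hlZ
    · rw [hfin, card_insert_of_notMem hv.2, hcard]
    · simp only [List.length_append, List.length_cons] at hlen ⊢
      omega

/-- Stuttering at the first vertex pads all walks to a common length, so that a single count covers
linked sets of every size up to `s`. -/
lemma exists_chain_length_add {R : V → V → Prop} (hrefl : ∀ x, R x x) {l : List V}
    (hl : l.IsChain R) (hne : l ≠ []) (m : ℕ) :
    ∃ l' : List V, l'.IsChain R ∧ l'.toFinset = l.toFinset ∧ l'.length = l.length + m := by
  induction m with
  | zero => exact ⟨l, hl, rfl, rfl⟩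
  | succ m ih =>
    obtain ⟨l', h1, h2, h3⟩ := ih
    match l', h1, h2, h3 with
    | [], _, _, h3 =>
      have := List.length_pos_iff.2 hne
      simp at h3
      omega
    | x :: t, h1, h2, h3 =>
      refine ⟨x :: x :: t, List.isChain_cons_cons.2 ⟨hrefl x, h1⟩, ?_, ?_⟩
      · rw [← h2]; simp
      · simp only [List.length_cons] at h3 ⊢; omega

/-- The number of chains of given length is exponential in the length. -/
lemma exists_finset_chains [Fintype V] (R : V → V → Prop) [DecidableRel R] {Δ : ℕ}
    (hΔ : ∀ x, #{y | R x y} ≤ Δ) (L : ℕ) :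
    ∃ 𝓛 : Finset (List V), #𝓛 ≤ Fintype.card V * Δ ^ L ∧
      ∀ l : List V, l.IsChain (fun x y => R y x) → l.length = L + 1 → l ∈ 𝓛 := by
  induction L with
  | zero =>
    refine ⟨univ.image fun x => [x], by simpa using card_image_le (s := (univ : Finset V)), ?_⟩
    intro l _ hlen
    obtain ⟨x, rfl⟩ := List.length_eq_one_iff.1 hlen
    simp
  | succ L ih =>
    obtain ⟨𝓛, h1, h2⟩ := ih
    refine ⟨𝓛.biUnion fun l => match l with
      | [] => ∅
      | x :: t => ({y | R x y} : Finset V).image fun y => y :: x :: t, ?_, ?_⟩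
    · refine (card_biUnion_le_card_mul _ _ Δ ?_).trans ?_
      · intro l _
        match l with
        | [] => simp
        | x :: t => exact card_image_le.trans (hΔ x)
      · rw [pow_succ, ← mul_assoc]
        exact Nat.mul_le_mul_right _ h1
    · intro l hl hlen
      match l, hl, hlen with
      | [], _, hlen => simp at hlen
      | [y], _, hlen => simp at hlen
      | y :: x :: t, hl, hlen =>
        rw [List.isChain_cons_cons] at hl
        refine mem_biUnion.2 ⟨x :: t, h2 _ hl.2 (by simpa using hlen), ?_⟩
        simpa using hl.1

/-- The number of small linked sets. -/
lemma exists_finset_linked [Fintype V] (R : V → V → Prop) [DecidableRel R] {Δ : ℕ}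
    (hrefl : ∀ x, R x x) (hsymm : ∀ x y, R x y → R y x) (hΔ : ∀ x, #{y | R x y} ≤ Δ) (s : ℕ) :
    ∃ 𝒯 : Finset (Finset V), #𝒯 ≤ Fintype.card V * Δ ^ (2 * s) ∧ (∀ Z ∈ 𝒯, #Z ≤ s) ∧
      ∀ Z, Z.Nonempty → IsLinkedBy R Z → #Z ≤ s → Z ∈ 𝒯 := by
  obtain ⟨𝓛, h1, h2⟩ := exists_finset_chains R hΔ (2 * s)
  refine ⟨{Z ∈ 𝓛.image List.toFinset | #Z ≤ s},
    (card_filter_le _ _).trans (card_image_le.trans h1), fun Z hZ => (mem_filter.1 hZ).2, ?_⟩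
  intro Z hne hZ hs
  have hpos := hne.card_pos
  obtain ⟨l, hl, hlZ, hcard, hlen⟩ := hZ.exists_chain hsymm hne (#Z - 1) (by omega)
  have hlZ' : l.toFinset = Z := eq_of_subset_of_card_le hlZ (by omega)
  obtain ⟨l', hl', hfin, hlen'⟩ := exists_chain_length_add hrefl hl
    (by rintro rfl; simp at hlen) (2 * s + 1 - (2 * (#Z - 1) + 1))
  refine mem_filter.2 ⟨mem_image.2 ⟨l', h2 l' (hl'.imp hsymm) (by omega), ?_⟩, hs⟩
  rw [hfin, hlZ']

end Walks

/-! ### The container bound -/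

namespace UpGraph.ClosedFamily

variable {V : Type*} [DecidableEq V] {Γ : UpGraph V} {ι : Type*} {𝓕 : Γ.ClosedFamily ι}

/-- In terms of `x = T log n / n`, the starting point of the walk (`n ≤ 96 x`), its steps, the
splitting of the certificate and the halvings all cost `O(x log n)`, while the gain on the right is
at least `15000 x log n`. -/
lemma certificates_exponent_le {n T ℓ Λ : ℝ} {s k : ℕ} (hn : 3 ≤ n) (hℓ : 1 ≤ ℓ)
    (hTn : n ^ 2 ≤ 96 * T) (hs : (s : ℝ) ≤ 170 * (T * ℓ / n)) (hk : (k : ℝ) ≤ 2 * ℓ)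
    (hΛ : 30000 * (ℓ ^ 2 / √n) ≤ Λ) :
    n + 56 * ℓ * s + 5 * s + k * (66 * (T * ℓ / n)) ≤ Λ * (T / (2 * √n)) := by
  have hn0 : 0 < n := by linarith
  have hT0 : 0 < T := by nlinarith
  have hsq : 0 < √n := Real.sqrt_pos.2 hn0
  have hss : √n * √n = n := Real.mul_self_sqrt hn0.le
  obtain ⟨x, hx⟩ : ∃ x, x = T * ℓ / n := ⟨_, rfl⟩
  rw [← hx] at hs ⊢
  have hx0 : 0 < x := by rw [hx]; positivity
  have h1 : n ≤ 96 * x := by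
    have h2 : n ≤ 96 * (T / n) := by
      rw [← mul_div_assoc, le_div_iff₀ hn0]; linarith
    have h3 : T / n ≤ x := by
      rw [hx]
      exact div_le_div_of_nonneg_right (le_mul_of_one_le_right hT0.le hℓ) hn0.le
    linarith
  have hxl : x ≤ x * ℓ := le_mul_of_one_le_right hx0.le hℓ
  have h4 : ℓ * s ≤ ℓ * (170 * x) := mul_le_mul_of_nonneg_left hs (by linarith)
  have h5 : k * (66 * x) ≤ 2 * ℓ * (66 * x) := mul_le_mul_of_nonneg_right hk (by positivity)
  have h6 : 15000 * (x * ℓ) ≤ Λ * (T / (2 * √n)) := by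
    refine le_trans (le_of_eq ?_) (mul_le_mul_of_nonneg_right hΛ (by positivity))
    have e : 30000 * (ℓ ^ 2 / √n) * (T / (2 * √n)) = 15000 * (ℓ ^ 2 * T / (√n * √n)) := by
      field_simp
      ring
    rw [e, hss, hx]
    ring
  nlinarith

/-- The container bound for a weighted family of closed sets all of whose nets are linked. -/
theorem sum_weight_le [Fintype V] (hV : Fintype.card V ≤ 2 ^ Γ.n)
    (hball : ∀ x, #{y | Γ.dist x y ≤ 14} ≤ (Γ.n + 1) ^ 14)
    (hlink : ∀ p ∈ 𝓕.P, ∀ Z : Finset V, (∀ x ∈ 𝓕.C p, ∃ z ∈ Z, Γ.dist x z ≤ 3) →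
      (∀ z ∈ Z, ∃ x ∈ 𝓕.C p, Γ.dist x z ≤ 3) → IsLinkedBy (fun x y => Γ.dist x y ≤ 14) Z) :
    ∑ p ∈ 𝓕.P, 𝓕.W p ≤ Real.exp (𝓕.Λ * (𝓕.g - 𝓕.T / (2 * √Γ.n) - 𝓕.h)) := by
  have hn := Γ.three_le_n
  have hn0 := Γ.n_pos
  have hT0 := 𝓕.T_pos
  have hℓ := one_le_log (Γ := Γ)
  obtain ⟨s, hs⟩ : ∃ s : ℕ, s = ⌊170 * (𝓕.T * Real.log Γ.n / Γ.n)⌋₊ := ⟨_, rfl⟩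
  have hs1 : (s : ℝ) ≤ 170 * (𝓕.T * Real.log Γ.n / Γ.n) := by
    rw [hs]; exact Nat.floor_le (by positivity)
  -- The number of halvings from `n / 4` to `√n` is at most this; the surplus is harmless since the
  -- iteration may stop early.
  obtain ⟨k, hk⟩ : ∃ k : ℕ, k = Nat.log 2 Γ.n := ⟨_, rfl⟩
  have hk1 : (k : ℝ) ≤ 2 * Real.log Γ.n := by
    have h1 : (2 : ℝ) ^ k ≤ Γ.n := by
      rw [hk]
      exact_mod_cast Nat.pow_log_le_self 2 (by have := Γ.three_le; omega : Γ.n ≠ 0)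
    have h2 := Real.log_le_log (by positivity) h1
    rw [Real.log_pow] at h2
    have := Real.log_two_gt_d9
    nlinarith [Nat.cast_nonneg (α := ℝ) k]
  have hs_one : 1 ≤ √(Γ.n : ℝ) := by rw [Real.one_le_sqrt]; linarith
  have hss : √(Γ.n : ℝ) * √Γ.n = Γ.n := Real.mul_self_sqrt hn0.le
  have hk2 : (Γ.n : ℝ) / 4 ≤ 2 ^ k * √Γ.n := by
    have h1 : (Γ.n : ℝ) < 2 ^ (k + 1) := by
      rw [hk]
      exact_mod_cast Nat.lt_pow_succ_log_self (by norm_num) Γ.n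
    rw [pow_succ] at h1
    have h2 : (2 : ℝ) ^ k ≤ 2 ^ k * √Γ.n := le_mul_of_one_le_right (by positivity) hs_one
    linarith
  obtain ⟨𝒯, h𝒯card, h𝒯s, h𝒯⟩ := exists_finset_linked (fun x y => Γ.dist x y ≤ 14)
    (fun x => by rw [Γ.dist_self]; omega) (fun x y h => by rwa [Γ.dist_comm]) hball s
  -- Only the union of the five parts of a certificate is linked; the parts are recovered as subsets
  -- of it, at a cost of `2 ^ (5 s)`.
  let 𝒵 : Finset (Finset V × Finset V × Finset V × Finset V × Finset V) :=
    𝒯.biUnion fun Z => Z.powerset ×ˢ Z.powerset ×ˢ Z.powerset ×ˢ Z.powerset ×ˢ Z.powerset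
  have h𝒵card : (#𝒵 : ℝ) ≤ Real.exp (Γ.n + 56 * Real.log Γ.n * s + 5 * s) := by
    have h1 : #𝒵 ≤ #𝒯 * (2 ^ s) ^ 5 := by
      refine card_biUnion_le_card_mul _ _ _ fun Z hZ => ?_
      simp only [card_product, card_powerset]
      have h2 : 2 ^ #Z ≤ 2 ^ s := Nat.pow_le_pow_right (by norm_num) (h𝒯s Z hZ)
      calc 2 ^ #Z * (2 ^ #Z * (2 ^ #Z * (2 ^ #Z * 2 ^ #Z))) = (2 ^ #Z) ^ 5 := by ring
        _ ≤ _ := Nat.pow_le_pow_left h2 5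
    have h2 : #𝒵 ≤ 2 ^ Γ.n * ((Γ.n + 1) ^ 14) ^ (2 * s) * (2 ^ s) ^ 5 :=
      h1.trans (Nat.mul_le_mul_right _ (h𝒯card.trans (Nat.mul_le_mul_right _ hV)))
    have h3 : (#𝒵 : ℝ) ≤ 2 ^ Γ.n * (((Γ.n : ℝ) + 1) ^ 14) ^ (2 * s) * (2 ^ s) ^ 5 := by
      exact_mod_cast h2
    have h4 : (2 : ℝ) ≤ Real.exp 1 := by
      have := Real.add_one_le_exp (1 : ℝ); linarith
    have h5 : (Γ.n : ℝ) + 1 ≤ Real.exp (2 * Real.log Γ.n) := by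
      rw [two_mul, Real.exp_add, Real.exp_log hn0]
      nlinarith
    refine h3.trans ?_
    calc (2 : ℝ) ^ Γ.n * (((Γ.n : ℝ) + 1) ^ 14) ^ (2 * s) * (2 ^ s) ^ 5
        ≤ Real.exp 1 ^ Γ.n * (Real.exp (2 * Real.log Γ.n) ^ 14) ^ (2 * s)
          * (Real.exp 1 ^ s) ^ 5 := by gcongr
      _ = _ := by
        rw [← pow_mul, ← pow_mul, ← Real.exp_nat_mul, ← Real.exp_nat_mul, ← Real.exp_nat_mul,
          ← Real.exp_add, ← Real.exp_add]
        congr 1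
        push_cast
        ring
  classical
  have hB := fun {F S : Finset V} (hA : Γ.IsApprox (Γ.n / 4) F S) =>
    sum_between_le_pow (𝓕 := 𝓕) k hA le_rfl (by nlinarith) hk2
  refine (sum_le_card_mul_of_cover (Z := 𝒵) 𝓕.W_nonneg
    (fun p z => Γ.IsApprox (Γ.n / 4) (Γ.certInner z.1 z.2.1 z.2.2.1 z.2.2.2.1 z.2.2.2.2)
        (Γ.certOuter z.1 z.2.1 z.2.2.1 z.2.2.2.1 z.2.2.2.2) ∧
      Γ.certInner z.1 z.2.1 z.2.2.1 z.2.2.2.1 z.2.2.2.2 ⊆ Γ.nb (𝓕.C p) ∧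
      𝓕.C p ⊆ Γ.certOuter z.1 z.2.1 z.2.2.1 z.2.2.2.1 z.2.2.2.2) ?_
    (B := Real.exp (66 * (𝓕.T * Real.log Γ.n / Γ.n)) ^ k *
      Real.exp (𝓕.Λ * (𝓕.g - 𝓕.T / √Γ.n - 𝓕.h))) ?_).trans ?_
  · intro p hp
    obtain ⟨D, Ω, H, U, W, Z, hZ, hA, hin, hout, hcard, hnear, hnear'⟩ :=
      exists_certificate (𝓕.closed p hp) (excess hp).symm
        (by rw [𝓕.card_C p hp]; exact 𝓕.c_le) (by rw [𝓕.card_nb p hp]; exact 𝓕.le_g) 𝓕.le_T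
    refine ⟨(D, Ω, H, U, W), mem_biUnion.2 ⟨Z, h𝒯 Z ?_ (hlink p hp Z hnear hnear') ?_, ?_⟩,
      hA, hin, hout⟩
    · have h1 : 0 < #(Γ.nb (𝓕.C p)) := by
        rw [𝓕.card_nb p hp]
        exact lt_of_lt_of_le (pow_pos (by have := Γ.three_le; omega) 2) 𝓕.le_g
      obtain ⟨y, hy⟩ := card_pos.1 h1
      obtain ⟨x, hx, _⟩ := mem_nb.1 hy
      obtain ⟨z, hz, _⟩ := hnear x hx
      exact ⟨z, hz⟩
    · rw [hs]; exact Nat.le_floor hcard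
    · simp only [mem_product, mem_powerset]
      rw [hZ]
      refine ⟨?_, ?_, ?_, ?_, ?_⟩ <;> intro x hx <;> simp [hx]
  · intro z _
    rcases em (Γ.IsApprox (Γ.n / 4) (Γ.certInner z.1 z.2.1 z.2.2.1 z.2.2.2.1 z.2.2.2.2)
        (Γ.certOuter z.1 z.2.1 z.2.2.1 z.2.2.2.1 z.2.2.2.2)) with hA | hA
    · refine le_trans (le_of_eq (sum_congr ?_ fun _ _ => rfl)) (hB hA)
      ext p
      simp only [mem_filter, mem_between, hA, true_and]
    · simp only [hA, false_and, filter_false, sum_empty]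
      positivity
  · rw [← Real.exp_nat_mul, ← Real.exp_add]
    refine (mul_le_mul_of_nonneg_right h𝒵card (Real.exp_pos _).le).trans ?_
    rw [← Real.exp_add, Real.exp_le_exp]
    -- Half of the gain `Λ T / √n` pays for the certificates and the halvings; the other half
    -- remains in the conclusion.
    have hfin := certificates_exponent_le hn hℓ 𝓕.le_T hs1 hk1 𝓕.le_Λ
    have e : 𝓕.T / √Γ.n = 2 * (𝓕.T / (2 * √Γ.n)) := by
      have : √(Γ.n : ℝ) ≠ 0 := by positivity
      field_simp
    rw [e]
    linarith

end UpGraph.ClosedFamily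

/-! ### Shadows in the Boolean lattice -/

namespace BooleanLattice

variable {n r : ℕ}

lemma mem_layer {i : ℕ} {x : Finset (Fin n)} : x ∈ layer n i ↔ #x = i := by
  simp [layer, mem_powersetCard]

lemma mem_upShadow_singleton {x y : Finset (Fin n)} :
    y ∈ upShadow {x} ↔ ∃ a ∉ x, insert a x = y := by
  simp [mem_upShadow_iff]

lemma card_of_mem_upShadow {i : ℕ} {A : Finset (Finset (Fin n))} (hA : A ⊆ layer n i)
    {y : Finset (Fin n)} (hy : y ∈ upShadow A) : #y = i + 1 := by
  obtain ⟨x, hx, a, ha, rfl⟩ := mem_upShadow_iff.1 hy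
  rw [card_insert_of_notMem ha, mem_layer.1 (hA hx)]

lemma card_of_mem_upShadow_singleton {x y : Finset (Fin n)} (hy : y ∈ upShadow {x}) :
    #y = #x + 1 :=
  card_of_mem_upShadow (i := #x) (by simp [mem_layer]) hy

lemma card_upShadow_singleton (x : Finset (Fin n)) : #(upShadow {x}) = n - #x := by
  have : upShadow {x} = xᶜ.image fun a => insert a x := by
    ext y
    simp [mem_upShadow_iff]
  rw [this, card_image_of_injOn, card_compl, Fintype.card_fin]
  intro a ha b _ hab
  have ha' : a ∉ x := by simpa using ha
  have hab' : insert a x = insert b x := hab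
  have : a ∈ insert b x := hab' ▸ mem_insert_self a x
  exact (mem_insert.1 this).resolve_right ha'

lemma card_filter_mem_upShadow_le (S : Finset (Finset (Fin n))) (y : Finset (Fin n)) :
    #{x ∈ S | y ∈ upShadow {x}} ≤ #y := by
  have : {x ∈ S | y ∈ upShadow {x}} ⊆ y.image fun a => y.erase a := by
    intro x hx
    obtain ⟨a, ha, rfl⟩ := mem_upShadow_singleton.1 (mem_filter.1 hx).2
    exact mem_image.2 ⟨a, mem_insert_self _ _, erase_insert ha⟩
  exact (card_le_card this).trans card_image_le

/-- A common upper neighbour of two distinct sets of equal size must be their union. -/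
lemma card_upShadow_inter_le {x x' : Finset (Fin n)} (h : #x = #x') (hne : x ≠ x') :
    #(upShadow {x} ∩ upShadow {x'}) ≤ 1 := by
  have key : ∀ y ∈ upShadow {x} ∩ upShadow {x'}, y = x ∪ x' := by
    intro y hy
    rw [mem_inter] at hy
    have h1 := card_of_mem_upShadow_singleton hy.1
    obtain ⟨a, ha, hay⟩ := mem_upShadow_singleton.1 hy.1
    obtain ⟨b, hb, hby⟩ := mem_upShadow_singleton.1 hy.2
    have hx : x ⊆ y := hay ▸ subset_insert _ _
    have hx' : x' ⊆ y := hby ▸ subset_insert _ _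
    refine (eq_of_subset_of_card_le (union_subset hx hx') ?_).symm
    rw [h1]
    by_contra! hlt
    have h2 : x = x ∪ x' := eq_of_subset_of_card_le subset_union_left (by omega)
    have h3 : x' ⊆ x := by rw [h2]; exact subset_union_right
    exact hne (eq_of_subset_of_card_le h3 (by omega)).symm
  exact card_le_one.2 fun y hy z hz => (key y hy).trans (key z hz).symm

lemma card_symmDiff_triangle (x y z : Finset (Fin n)) :
    #(symmDiff x z) ≤ #(symmDiff x y) + #(symmDiff y z) :=
  (card_le_card (symmDiff_triangle x y z)).trans (card_union_le _ _)

lemma card_symmDiff_of_subset {x y : Finset (Fin n)} (h : x ⊆ y) :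
    #(symmDiff x y) = #y - #x := by
  rw [symmDiff_of_le h, card_sdiff_of_subset h]

/-- The two layers below the `r`-th one, with their upper neighbourhoods. -/
noncomputable def upGraph (n r : ℕ) (hr : 2 ≤ r) (hrn : 2 * r ≤ n + 1) :
    UpGraph (Finset (Fin n)) where
  X := layer n (r - 1) ∪ layer n (r - 2)
  N x := upShadow {x}
  -- This is the reciprocal of the up-degree of any set just below `y`, so both layers are
  -- normalized at once. The dual inequality becomes `#y ≤ n + 1 - #y`, which is where `2 * r ≤ n +
  -- 1` enters.
  w y := ((n : ℝ) + 1 - #y)⁻¹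
  n := n
  dist x y := #(symmDiff x y)
  three_le := by omega
  w_nonneg y := by
    have : #y ≤ n := card_finset_fin_le y
    have : (#y : ℝ) ≤ n := by exact_mod_cast this
    rw [inv_nonneg]; linarith
  sum_w x hx := by
    have hx' : #x < n := by
      simp only [mem_union, mem_layer] at hx; omega
    have h1 : ∀ y ∈ upShadow {x}, ((n : ℝ) + 1 - #y)⁻¹ = ((n : ℝ) - #x)⁻¹ := by
      intro y hy
      rw [card_of_mem_upShadow_singleton hy]
      push_cast
      congr 1
      ring
    rw [sum_congr rfl h1, sum_const, card_upShadow_singleton, nsmul_eq_mul,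
      Nat.cast_sub hx'.le, mul_inv_cancel₀]
    have : (#x : ℝ) < n := by exact_mod_cast hx'
    linarith
  w_mul_le y := by
    rcases (filter (fun x => y ∈ upShadow {x})
      (layer n (r - 1) ∪ layer n (r - 2))).eq_empty_or_nonempty with he | ⟨x, hx⟩
    · rw [he]; simp
    · rw [mem_filter] at hx
      have hy : #y ≤ r := by
        have := card_of_mem_upShadow_singleton hx.2
        simp only [mem_union, mem_layer] at hx
        omega
      have hle := card_filter_mem_upShadow_le (layer n (r - 1) ∪ layer n (r - 2)) y
      have h1 : (#{x ∈ layer n (r - 1) ∪ layer n (r - 2) | y ∈ upShadow {x}} : ℝ)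
          ≤ (n : ℝ) + 1 - #y := by
        rw [le_sub_iff_add_le]
        exact_mod_cast (by omega :
          #{x ∈ layer n (r - 1) ∪ layer n (r - 2) | y ∈ upShadow {x}} + #y ≤ n + 1)
      have h2 : (0 : ℝ) < (n : ℝ) + 1 - #y := by
        rw [sub_pos]
        exact_mod_cast (by omega : #y < n + 1)
      rw [inv_mul_le_iff₀ h2]
      linarith
  le_w x hx y hy := by
    have h1 := card_of_mem_upShadow_singleton hy
    have h2 : #y ≤ n := card_finset_fin_le y
    have h1' : (1 : ℝ) ≤ #y := by exact_mod_cast (by omega : 1 ≤ #y)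
    have h2' : (#y : ℝ) ≤ n := by exact_mod_cast h2
    rw [← div_eq_mul_inv, le_div_iff₀ (by linarith)]
    linarith
  w_le x hx y hy := by
    have h1 := card_of_mem_upShadow_singleton hy
    have h2 : #y ≤ r := by
      simp only [mem_union, mem_layer] at hx; omega
    have h3 : (n : ℝ) + 2 * #y ≤ 2 * (n + 1) := by
      exact_mod_cast (by omega : n + 2 * #y ≤ 2 * (n + 1))
    have h4 : (#y : ℝ) < n + 1 := by exact_mod_cast (by omega : #y < n + 1)
    rw [← div_eq_mul_inv, div_le_iff₀ (by linarith)]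
    linarith
  codegree x hx x' hx' hne := by
    by_cases h : #x = #x'
    · exact card_upShadow_inter_le h hne
    · have : upShadow {x} ∩ upShadow {x'} = ∅ := by
        rw [eq_empty_iff_forall_notMem]
        intro y hy
        rw [mem_inter] at hy
        have h1 := card_of_mem_upShadow_singleton hy.1
        have h2 := card_of_mem_upShadow_singleton hy.2
        omega
      simp [this]
  dist_self x := by simp
  dist_comm x y := by rw [symmDiff_comm]
  dist_triangle := card_symmDiff_triangle
  dist_le_one x y hy := by
    have h1 := card_of_mem_upShadow_singleton hy
    obtain ⟨a, ha, hay⟩ := mem_upShadow_singleton.1 hy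
    rw [card_symmDiff_of_subset (hay ▸ subset_insert a x)]
    omega

lemma card_ball_zero_le (n k : ℕ) : #{s : Finset (Fin n) | #s ≤ k} ≤ (n + 1) ^ k := by
  induction k with
  | zero =>
    refine card_le_one.2 fun x hx y hy => ?_
    simp only [mem_filter, mem_univ, true_and, nonpos_iff_eq_zero, card_eq_zero] at hx hy
    rw [hx, hy]
  | succ k ih =>
    have hsub : ({s | #s ≤ k + 1} : Finset (Finset (Fin n))) ⊆
        ({s | #s ≤ k} : Finset (Finset (Fin n))) ∪
        (({s | #s ≤ k} : Finset (Finset (Fin n))) ×ˢ (univ : Finset (Fin n))).image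
          fun p => insert p.2 p.1 := by
      intro s hs
      simp only [mem_filter, mem_univ, true_and] at hs
      rw [mem_union, mem_filter]
      by_cases h : #s ≤ k
      · exact Or.inl ⟨mem_univ _, h⟩
      · right
        obtain ⟨a, ha⟩ := card_pos.1 (by omega : 0 < #s)
        refine mem_image.2 ⟨(s.erase a, a), ?_, insert_erase ha⟩
        simp [card_erase_of_mem ha]
        omega
    calc _ ≤ _ := card_le_card hsub
      _ ≤ (n + 1) ^ k + (n + 1) ^ k * n := by
        refine (card_union_le _ _).trans (add_le_add ih (card_image_le.trans ?_))
        rw [card_product, card_univ, Fintype.card_fin]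
        exact Nat.mul_le_mul_right _ ih
      _ = _ := by ring

lemma card_ball_le (k : ℕ) (x : Finset (Fin n)) :
    #{y | #(symmDiff x y) ≤ k} ≤ (n + 1) ^ k := by
  refine le_trans ?_ (card_ball_zero_le n k)
  refine card_le_card_of_injOn (fun y => symmDiff x y) ?_ ?_
  · intro y hy
    simpa using hy
  · exact fun y _ z _ h => symmDiff_right_injective x h

/-- Upper shadows in the lower half of the cube of families of quadratic size are cubic. -/
lemma cube_le_card_upShadow {A : Finset (Finset (Fin n))} (hr : 3 ≤ r) (hrn : 2 * r ≤ n + 1)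
    (hA : A ⊆ layer n (r - 1)) (hcard : n ^ 2 ≤ #A) : n ^ 3 ≤ 48 * #(upShadow A) := by
  -- Complements turn upper shadows into shadows of `s`-sets. As `s + 2 ≤ n`, there are at least `(s
  -- + 2).choose s` of them, so by Kruskal–Katona the shadow has at least `(s + 2).choose 3 ≥ s³ /
  -- 6` members, and `n ≤ 2s`.
  obtain ⟨s, hs⟩ : ∃ s, s = n - (r - 1) := ⟨_, rfl⟩
  have hsized : Set.Sized s (A.compls : Set (Finset (Fin n))) := by
    intro x hx
    rw [mem_coe, mem_compls] at hx
    have h1 := mem_layer.1 (hA hx)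
    rw [card_compl, Fintype.card_fin] at h1
    have : #x ≤ n := card_finset_fin_le x
    omega
  have h1 : (s + 2).choose s ≤ #A.compls := by
    rw [card_compls]
    refine le_trans ?_ hcard
    rw [Nat.choose_symm_add, Nat.choose_two_right]
    calc (s + 2) * (s + 2 - 1) / 2 ≤ (s + 2) * (s + 2 - 1) := Nat.div_le_self _ _
      _ ≤ n * n := Nat.mul_le_mul (by omega) (by omega)
      _ = n ^ 2 := by ring
  have h2 := kruskal_katona_lovasz_form (i := 1) (by omega) (by omega : s ≤ s + 2)
    (by omega : s + 2 ≤ n) hsized h1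
  rw [Function.iterate_one, shadow_compls, card_compls] at h2
  have h3 : (s + 2).choose (s - 1) = (s + 2).choose 3 := by
    rw [← Nat.choose_symm (by omega : 3 ≤ s + 2)]
    congr 1
  have h4 : 6 * (s + 2).choose 3 = (s + 2) * (s + 1) * s := by
    have e1 := Nat.choose_succ_right_eq (s + 2) 2
    have e2 := Nat.choose_succ_right_eq (s + 2) 1
    rw [Nat.choose_one_right] at e2
    simp only [Nat.reduceAdd, Nat.add_sub_cancel] at e1 e2
    have e3 : s + 2 - 1 = s + 1 := by omega
    rw [e3] at e2
    calc 6 * (s + 2).choose 3 = 2 * ((s + 2).choose 3 * 3) := by ring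
      _ = ((s + 2).choose 2 * 2) * s := by rw [e1]; ring
      _ = _ := by rw [e2]
  have h5 : s * s * s ≤ (s + 2) * (s + 1) * s := by gcongr <;> omega
  have h6 : n ^ 3 ≤ (2 * s) ^ 3 := Nat.pow_le_pow_left (by omega) 3
  have h7 : (2 * s) ^ 3 = 8 * (s * s * s) := by ring
  omega

end BooleanLattice

/-! ### Closures, linkedness and the weights of pairs -/

namespace BooleanLattice

variable {n r : ℕ}

lemma card_symmDiff_le_length {i : ℕ} {u v : twoLayers n i}
    (p : ((comparabilityGraph n).induce (twoLayers n i)).Walk u v) :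
    #(symmDiff (u : Finset (Fin n)) v) ≤ p.length := by
  induction p with
  | nil => simp
  | @cons u v w h p ih =>
    have h1 : #(symmDiff (u : Finset (Fin n)) v) ≤ 1 := by
      have hu : #(u : Finset (Fin n)) = i ∨ #(u : Finset (Fin n)) = i + 1 := by
        simpa [twoLayers, mem_layer] using u.2
      have hv : #(v : Finset (Fin n)) = i ∨ #(v : Finset (Fin n)) = i + 1 := by
        simpa [twoLayers, mem_layer] using v.2
      have h' : (u : Finset (Fin n)) ⊂ v ∨ (v : Finset (Fin n)) ⊂ u := h
      rcases h' with h' | h'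
      · rw [card_symmDiff_of_subset h'.1]; omega
      · rw [symmDiff_comm, card_symmDiff_of_subset h'.1]; omega
    have h2 := card_symmDiff_triangle (u : Finset (Fin n)) v w
    rw [SimpleGraph.Walk.length_cons]
    omega

/-- A path in `G²[A]` from a part of `A` to the rest has an edge crossing over, and each step of `G`
changes only one element. -/
lemma LayerTwoLinked.isLinkedBy {i : ℕ} {A : Finset (Finset (Fin n))} (hA : A ⊆ layer n i)
    (h : LayerTwoLinked n i A) : IsLinkedBy (fun x y => #(symmDiff x y) ≤ 2) A := by
  intro A₁ hA₁ ⟨u, hu⟩ hne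
  obtain ⟨v, hv, hv'⟩ : ∃ v ∈ A, v ∉ A₁ := by
    by_contra! hall
    exact hne (subset_antisymm hA₁ hall)
  have hmem : ∀ x ∈ A, x ∈ twoLayers n i := fun x hx => Or.inl (hA hx)
  obtain ⟨p⟩ := h.preconnected ⟨⟨u, hmem u (hA₁ hu)⟩, hA₁ hu⟩ ⟨⟨v, hmem v hv⟩, hv⟩
  obtain ⟨d, _, hd1, hd2⟩ := p.exists_boundary_dart {x | ((x : twoLayers n i) : Finset (Fin n)) ∈ A₁}
    hu hv'
  refine ⟨_, hd1, _, mem_sdiff.2 ⟨d.snd.2, hd2⟩, ?_⟩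
  have hadj : ((comparabilityGraph n).induce (twoLayers n i)).edist d.fst.1 d.snd.1 ≤ 2 :=
    d.adj.2
  obtain ⟨q, hq⟩ := SimpleGraph.exists_walk_of_edist_ne_top
    (ne_top_of_le_ne_top (by simp) hadj)
  rw [← hq] at hadj
  have h2 : q.length ≤ 2 := by exact_mod_cast hadj
  exact (card_symmDiff_le_length q).trans h2

lemma subset_upClosure {i : ℕ} {A : Finset (Finset (Fin n))} (hA : A ⊆ layer n i) :
    A ⊆ upClosure n i A := fun _ hx =>
  mem_filter.2 ⟨hA hx, upShadow_monotone (singleton_subset_iff.2 hx)⟩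

lemma upShadow_upClosure {i : ℕ} {A : Finset (Finset (Fin n))} (hA : A ⊆ layer n i) :
    upShadow (upClosure n i A) = upShadow A := by
  refine subset_antisymm (fun y hy => ?_) (upShadow_monotone (subset_upClosure hA))
  obtain ⟨x, hx, a, ha, hxy⟩ := mem_upShadow_iff.1 hy
  exact (mem_filter.1 hx).2 (mem_upShadow_singleton.2 ⟨a, ha, hxy⟩)

lemma upClosure_subset (i : ℕ) (A : Finset (Finset (Fin n))) : upClosure n i A ⊆ layer n i :=
  filter_subset _ _

lemma nb_upGraph (hr : 2 ≤ r) (hrn : 2 * r ≤ n + 1) (S : Finset (Finset (Fin n))) :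
    (upGraph n r hr hrn).nb S = upShadow S := by
  ext y
  rw [UpGraph.mem_nb, mem_upShadow_iff]
  exact exists_congr fun x => and_congr_right fun _ => mem_upShadow_singleton

/-- The closed set attached to a pair `(A, B)`. -/
def pairClosure (n r : ℕ) (p : Finset (Finset (Fin n)) × Finset (Finset (Fin n))) :
    Finset (Finset (Fin n)) :=
  upClosure n (r - 1) p.1 ∪ upClosure n (r - 2) p.2

variable {A B : Finset (Finset (Fin n))}

lemma upShadow_union (A B : Finset (Finset (Fin n))) :
    upShadow (A ∪ B) = upShadow A ∪ upShadow B := by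
  ext y
  simp only [mem_upShadow_iff, mem_union, or_and_right, exists_or]

lemma upShadow_pairClosure (hA : A ⊆ layer n (r - 1)) (hB : B ⊆ layer n (r - 2)) :
    upShadow (pairClosure n r (A, B)) = upShadow A ∪ upShadow B := by
  rw [pairClosure, upShadow_union, upShadow_upClosure hA, upShadow_upClosure hB]

lemma disjoint_of_layers {i j : ℕ} (hij : i ≠ j) (hA : A ⊆ layer n i) (hB : B ⊆ layer n j) :
    Disjoint A B := by
  rw [disjoint_left]
  intro x hx hx'
  exact hij ((mem_layer.1 (hA hx)).symm.trans (mem_layer.1 (hB hx')))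

lemma upShadow_subset_layer {i : ℕ} (hA : A ⊆ layer n i) : upShadow A ⊆ layer n (i + 1) :=
  fun _ hy => mem_layer.2 (card_of_mem_upShadow hA hy)

/-- The upper shadows of `A` and `B` lie in different layers, so closedness can be checked in each
layer separately. -/
lemma isClosedSet_pairClosure (hr : 2 ≤ r) (hrn : 2 * r ≤ n + 1)
    (hA : A ⊆ layer n (r - 1)) (hB : B ⊆ layer n (r - 2)) :
    (upGraph n r hr hrn).IsClosedSet (pairClosure n r (A, B)) := by
  refine ⟨union_subset_union (upClosure_subset _ _) (upClosure_subset _ _), fun x hx hsub => ?_⟩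
  rw [nb_upGraph, upShadow_pairClosure hA hB] at hsub
  have hsub' : upShadow {x} ⊆ upShadow A ∪ upShadow B := hsub
  have hx' : x ∈ layer n (r - 1) ∪ layer n (r - 2) := hx
  rw [mem_union] at hx'
  rw [pairClosure, mem_union]
  rcases hx' with hx' | hx'
  · refine Or.inl (mem_filter.2 ⟨hx', fun y hy => ?_⟩)
    refine (mem_union.1 (hsub' hy)).resolve_right fun h => ?_
    have h1 := card_of_mem_upShadow hB h
    have h2 := card_of_mem_upShadow_singleton hy
    rw [mem_layer.1 hx'] at h2
    omega
  · refine Or.inr (mem_filter.2 ⟨hx', fun y hy => ?_⟩)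
    refine (mem_union.1 (hsub' hy)).resolve_left fun h => ?_
    have h1 := card_of_mem_upShadow hA h
    have h2 := card_of_mem_upShadow_singleton hy
    rw [mem_layer.1 hx'] at h2
    omega

/-- Sets of vertices that are close to the closure of a pair are linked. -/
lemma isLinkedBy_of_near (hr : 2 ≤ r) (hrn : 2 * r ≤ n + 1)
    (hA : A ⊆ layer n (r - 1)) (hB : B ⊆ layer n (r - 2)) (hBA : upShadow B ⊆ A)
    (hlink : LayerTwoLinked n (r - 1) A) {Z : Finset (Finset (Fin n))}
    (h1 : ∀ x ∈ pairClosure n r (A, B), ∃ z ∈ Z, #(symmDiff x z) ≤ 3)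
    (h2 : ∀ z ∈ Z, ∃ x ∈ pairClosure n r (A, B), #(symmDiff x z) ≤ 3) :
    IsLinkedBy (fun x y => #(symmDiff x y) ≤ 14) Z := by
  have hclose : ∀ x ∈ pairClosure n r (A, B), ∃ a ∈ A, #(symmDiff a x) ≤ 2 := by
    intro x hx
    have hcard : #x < n := by
      have := (isClosedSet_pairClosure hr hrn hA hB).1 hx
      have hx' : x ∈ layer n (r - 1) ∪ layer n (r - 2) := this
      simp only [mem_union, mem_layer] at hx'
      omega
    obtain ⟨y, hy⟩ : (upShadow {x}).Nonempty := by
      rw [← card_pos, card_upShadow_singleton]; omega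
    have hxy : #(symmDiff y x) ≤ 1 := by
      rw [symmDiff_comm]
      exact (upGraph n r hr hrn).dist_le_one x y hy
    rcases mem_union.1 hx with hx | hx
    · obtain ⟨a, haA, c, hc, hay⟩ := mem_upShadow_iff.1 ((mem_filter.1 hx).2 hy)
      refine ⟨a, haA, ?_⟩
      have h3 := card_symmDiff_triangle a y x
      have h4 : #(symmDiff a y) ≤ 1 :=
        (upGraph n r hr hrn).dist_le_one a y (mem_upShadow_singleton.2 ⟨c, hc, hay⟩)
      omega
    · exact ⟨y, hBA ((mem_filter.1 hx).2 hy), by omega⟩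
  have hnear : ∀ z ∈ Z, ∃ a ∈ A, #(symmDiff a z) ≤ 5 := by
    intro z hz
    obtain ⟨x, hx, hxz⟩ := h2 z hz
    obtain ⟨a, ha, hax⟩ := hclose x hx
    have := card_symmDiff_triangle a x z
    exact ⟨a, ha, by omega⟩
  intro Z₁ hZ₁ ⟨u₀, hu₀⟩ hne
  by_contra! hfar
  obtain ⟨v₀, hv₀, hv₀'⟩ : ∃ v ∈ Z, v ∉ Z₁ := by
    by_contra! hall
    exact hne (subset_antisymm hZ₁ hall)
  obtain ⟨a₀, ha₀, hau₀⟩ := hnear u₀ (hZ₁ hu₀)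
  obtain ⟨b₀, hb₀, hbv₀⟩ := hnear v₀ hv₀
  -- Split `A` according to distance at most 5 from `Z₁`. If all of `A` were near, then `v₀` would
  -- be within 10 of `Z₁`. Otherwise a crossing pair gives a connection of length at most `5 + 2 +
  -- 3`.
  obtain ⟨a, ha, b, hb, hab⟩ := hlink.isLinkedBy hA {a ∈ A | ∃ z ∈ Z₁, #(symmDiff a z) ≤ 5}
    (filter_subset _ _) ⟨a₀, mem_filter.2 ⟨ha₀, u₀, hu₀, hau₀⟩⟩ (by
      intro heq
      rw [← heq, mem_filter] at hb₀
      obtain ⟨z, hz, hbz⟩ := hb₀.2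
      have h3 := hfar z hz v₀ (mem_sdiff.2 ⟨hv₀, hv₀'⟩)
      have h4 := card_symmDiff_triangle z b₀ v₀
      rw [symmDiff_comm z b₀] at h4
      omega)
  obtain ⟨u, hu, hau⟩ := (mem_filter.1 ha).2
  rw [mem_sdiff] at hb
  obtain ⟨v, hv, hbv⟩ := h1 b (mem_union_left _ (subset_upClosure hA hb.1))
  have hv' : v ∉ Z₁ := fun h => hb.2 (mem_filter.2 ⟨hb.1, v, h, by omega⟩)
  have h3 := hfar u hu v (mem_sdiff.2 ⟨hv, hv'⟩)
  have h4 := card_symmDiff_triangle u a v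
  have h5 := card_symmDiff_triangle a b v
  rw [symmDiff_comm u a] at h4
  omega

/-- Summing weights over the sets between `H` and `S`. -/
lemma sum_zpow_card_of_subset {α : Type*} [DecidableEq α] (lam : ℝ)
    {H S : Finset α} (h : H ⊆ S) :
    ∑ A ∈ S.powerset with H ⊆ A, lam ^ ((#A : ℤ) - #H) = (1 + lam) ^ (#S - #H) := by
  rw [← card_sdiff_of_subset h]
  have h2 := sum_pow_mul_eq_add_pow lam 1 (S \ H)
  simp only [one_pow, mul_one] at h2
  rw [add_comm, ← h2]
  refine sum_nbij' (fun A => A \ H) (fun A => A ∪ H) ?_ ?_ ?_ ?_ ?_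
  · intro A hA
    simp only [mem_filter, mem_powerset] at hA ⊢
    exact sdiff_subset_sdiff hA.1 subset_rfl
  · intro A hA
    simp only [mem_filter, mem_powerset] at hA ⊢
    exact ⟨union_subset (hA.trans sdiff_subset) h, subset_union_right⟩
  · intro A hA
    simp only [mem_filter, mem_powerset] at hA
    exact sdiff_union_of_subset hA.2
  · intro A hA
    rw [mem_powerset] at hA
    rw [union_sdiff_right]
    exact sdiff_eq_self_of_disjoint (disjoint_of_subset_left hA sdiff_disjoint)
  · intro A hA
    simp only [mem_filter, mem_powerset] at hA
    rw [← zpow_natCast, card_sdiff_of_subset hA.2, Nat.cast_sub (card_le_card hA.2)]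

/-- The total weight of the pairs inside a given set. -/
lemma sum_pairs_le {lam : ℝ} (hlam : 0 < lam) {i j h : ℕ} (hij : i ≠ j)
    {P : Finset (Finset (Finset (Fin n)) × Finset (Finset (Fin n)))} {S : Finset (Finset (Fin n))}
    (hS : S ⊆ layer n i ∪ layer n j)
    (hP : ∀ p ∈ P, p.1 ⊆ layer n i ∧ p.2 ⊆ layer n j ∧ p.1 ⊆ S ∧ p.2 ⊆ S ∧
      upShadow p.2 ⊆ p.1 ∧ #(upShadow p.2) = h) :
    ∑ p ∈ P, lam ^ ((#p.1 : ℤ) + #p.2 - h) ≤ Real.exp (Real.log (1 + lam) * (#S - h)) := by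
  have hlam1 : 0 < 1 + lam := by linarith
  set S₁ := S ∩ layer n i with hS₁
  set S₂ := S ∩ layer n j with hS₂
  have hSS : S₁ ∪ S₂ = S := by
    rw [hS₁, hS₂, ← inter_union_distrib_left, inter_eq_left.2 hS]
  have hdis : Disjoint S₁ S₂ := disjoint_of_layers hij inter_subset_right inter_subset_right
  have hcardS : (#S : ℝ) = #S₁ + #S₂ := by
    rw [← hSS, card_union_of_disjoint hdis]; push_cast; ring
  have hsub : P ⊆ {p ∈ S₁.powerset ×ˢ S₂.powerset |
      #(upShadow p.2) = h ∧ upShadow p.2 ⊆ p.1} := by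
    intro p hp
    obtain ⟨h1, h2, h3, h4, h5, h6⟩ := hP p hp
    rw [mem_filter, mem_product, mem_powerset, mem_powerset]
    exact ⟨⟨subset_inter h3 h1, subset_inter h4 h2⟩, h6, h5⟩
  refine (sum_le_sum_of_subset_of_nonneg hsub fun p _ _ => by positivity).trans ?_
  -- With `B` fixed, the constraint `upShadow B ⊆ A` makes the sum over `A` equal to `(1 + lam) ^
  -- (#S₁ - h)`; the normalization by `h` cancels the forced part of `A`.
  rw [sum_filter, sum_product_right]
  have hinner : ∀ B ∈ S₂.powerset, (∑ A ∈ S₁.powerset,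
      if #(upShadow B) = h ∧ upShadow B ⊆ A then lam ^ ((#A : ℤ) + #B - h) else 0)
      ≤ lam ^ #B * Real.exp (Real.log (1 + lam) * (#S₁ - h)) := by
    intro B _
    by_cases hB : #(upShadow B) = h ∧ upShadow B ⊆ S₁
    · have e : ∀ A ∈ S₁.powerset,
          (if #(upShadow B) = h ∧ upShadow B ⊆ A then lam ^ ((#A : ℤ) + #B - h) else 0)
          = lam ^ #B * (if upShadow B ⊆ A then lam ^ ((#A : ℤ) - #(upShadow B)) else 0) := by
        intro A _
        rw [hB.1]
        simp only [true_and]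
        split_ifs
        · rw [← zpow_natCast, ← zpow_add₀ hlam.ne']
          congr 1
          ring
        · simp
      rw [sum_congr rfl e, ← mul_sum, ← sum_filter, sum_zpow_card_of_subset lam hB.2, hB.1]
      refine mul_le_mul_of_nonneg_left (le_of_eq ?_) (by positivity)
      have hle : h ≤ #S₁ := hB.1 ▸ card_le_card hB.2
      rw [← Nat.cast_sub hle, mul_comm, Real.exp_nat_mul, Real.exp_log hlam1]
    · refine le_trans (le_of_eq (sum_eq_zero fun A hA => ?_)) (by positivity)
      rw [if_neg]
      rintro ⟨h1, h2⟩
      exact hB ⟨h1, h2.trans (mem_powerset.1 hA)⟩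
  refine (sum_le_sum hinner).trans (le_of_eq ?_)
  have h2 := sum_pow_mul_eq_add_pow lam 1 S₂
  simp only [one_pow, mul_one] at h2
  rw [← sum_mul, h2, hcardS]
  have e : Real.log (1 + lam) * ((#S₁ : ℝ) + #S₂ - h)
      = #S₂ * Real.log (1 + lam) + Real.log (1 + lam) * (#S₁ - h) := by ring
  rw [e, Real.exp_add, Real.exp_nat_mul, Real.exp_log hlam1, add_comm lam 1]

/-- Families in the lower of the two layers expand by a factor of at least `1 + 1 / n`. -/
lemma card_le_mul_excess (hr : 2 ≤ r) (hrn : 2 * r ≤ n + 1) (hB : B ⊆ layer n (r - 2)) :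
    (#B : ℝ) ≤ n * ((#(upShadow B) : ℝ) - #B) := by
  have hdc : #B * (n - (r - 2)) ≤ #(upShadow B) * (r - 1) := by
    have h1 := sum_card_bipartiteAbove_eq_sum_card_bipartiteBelow (s := B) (t := upShadow B)
      (fun x y => y ∈ upShadow {x})
    have h2 : #B * (n - (r - 2))
        ≤ ∑ x ∈ B, #(bipartiteAbove (fun x y => y ∈ upShadow {x}) (upShadow B) x) := by
      rw [← smul_eq_mul]
      refine card_nsmul_le_sum _ _ _ fun x hx => ?_
      have : bipartiteAbove (fun x y => y ∈ upShadow {x}) (upShadow B) x = upShadow {x} := by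
        ext y
        simp only [bipartiteAbove, mem_filter, and_iff_right_iff_imp]
        exact fun h => upShadow_monotone (singleton_subset_iff.2 hx) h
      rw [this, card_upShadow_singleton, mem_layer.1 (hB hx)]
    have h3 : ∑ y ∈ upShadow B, #(bipartiteBelow (fun x y => y ∈ upShadow {x}) B y)
        ≤ #(upShadow B) * (r - 1) := by
      rw [← smul_eq_mul]
      refine sum_le_card_nsmul _ _ _ fun y hy => ?_
      refine (card_filter_mem_upShadow_le B y).trans ?_
      rw [card_of_mem_upShadow hB hy]
      omega
    exact h2.trans (h1.trans_le h3)
  have h1 : (#B : ℝ) * (n - (r - 2)) ≤ #(upShadow B) * (r - 1) := by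
    have : ((n - (r - 2) : ℕ) : ℝ) = n - (r - 2) := by
      rw [Nat.cast_sub (by omega), Nat.cast_sub hr]; norm_num
    rw [← this]
    have h3 : ((r - 1 : ℕ) : ℝ) = r - 1 := by rw [Nat.cast_sub (by omega)]; norm_num
    rw [← h3]
    exact_mod_cast hdc
  have hr' : (2 : ℝ) ≤ r := by exact_mod_cast hr
  have hrn' : 2 * (r : ℝ) ≤ n + 1 := by exact_mod_cast hrn
  have hB0 : (0 : ℝ) ≤ #B := Nat.cast_nonneg _
  -- The up-degree `n - r + 2` exceeds the down-degree bound `r - 1` by at least 2.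
  have h2 : (#B : ℝ) * 2 ≤ ((#(upShadow B) : ℝ) - #B) * (r - 1) := by nlinarith
  have h3 : 0 ≤ (#(upShadow B) : ℝ) - #B := by
    by_contra! hneg
    nlinarith
  nlinarith

/-- From `1 - x ≤ exp (-x)` one gets `exp x ≤ 1 + x * exp x`. Applied to `x = K * s ≤ K * M`, this
is why the constant `K * exp (K * M)` is large enough. -/
lemma le_log_one_add {C s lam M : ℝ} (hs : 0 ≤ s) (hsM : s ≤ M) {K : ℝ} (hK : 0 ≤ K)
    (hC : C = K * Real.exp (K * M)) (hlam : C * s ≤ lam) : K * s ≤ Real.log (1 + lam) := by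
  have hC0 : 0 ≤ C * s := by rw [hC]; positivity
  rw [Real.le_log_iff_exp_le (by linarith)]
  have h1 : Real.exp (K * s) ≤ 1 + K * s * Real.exp (K * s) := by
    have := Real.one_sub_le_exp_neg (K * s)
    rw [Real.exp_neg] at this
    have hpos := Real.exp_pos (K * s)
    have h2 := mul_le_mul_of_nonneg_right this hpos.le
    rw [inv_mul_cancel₀ hpos.ne'] at h2
    linarith
  have h2 : K * s * Real.exp (K * s) ≤ C * s := by
    have : Real.exp (K * s) ≤ Real.exp (K * M) :=
      Real.exp_le_exp.2 (mul_le_mul_of_nonneg_left hsM hK)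
    calc K * s * Real.exp (K * s) ≤ K * s * Real.exp (K * M) := by gcongr
      _ = C * s := by rw [hC]; ring
  linarith

lemma log_sq_div_sqrt_le {x : ℝ} (hx : 1 ≤ x) : Real.log x ^ 2 / √x ≤ 16 := by
  have hx0 : 0 ≤ x := by linarith
  have h1 := Real.log_le_rpow_div hx0 (by norm_num : (0 : ℝ) < 1 / 4)
  have h2 : (x ^ (1 / 4 : ℝ)) ^ 2 = √x := by
    rw [← Real.rpow_natCast, ← Real.rpow_mul hx0, Real.sqrt_eq_rpow]
    norm_num
  have h3 : Real.log x ≤ 4 * x ^ (1 / 4 : ℝ) := by linarith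
  rw [div_le_iff₀ (Real.sqrt_pos.2 (by linarith)), ← h2]
  have := pow_le_pow_left₀ (Real.log_nonneg hx) h3 2
  nlinarith

lemma log_le_logb_two {x : ℝ} (hx : 1 ≤ x) : Real.log x ≤ Real.logb 2 x := by
  rw [Real.logb, le_div_iff₀ (Real.log_pos (by norm_num))]
  have := Real.log_two_lt_d9
  nlinarith [Real.log_nonneg hx]

/-- The excess of a closed family of at least quadratic size is at least quadratic. -/
lemma sq_le_excess (hr : 2 ≤ r) (hrn : 2 * r ≤ n + 1) (hnr : n ≤ 2 * r + 1)
    (hA : A ⊆ layer n (r - 1)) (hcard : n ^ 2 ≤ #A)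
    (hexp : (#A : ℝ) ≤ n * ((#(upShadow A) : ℝ) - #A)) :
    (n : ℝ) ^ 2 ≤ 96 * ((#(upShadow A) : ℝ) - #A) := by
  have hn3 : (3 : ℝ) ≤ n := by exact_mod_cast (by omega : 3 ≤ n)
  have hcard' : (n : ℝ) ^ 2 ≤ #A := by exact_mod_cast hcard
  obtain ⟨t, ht⟩ : ∃ t, t = (#(upShadow A) : ℝ) - #A := ⟨_, rfl⟩
  rw [← ht] at hexp ⊢
  have h0 : (n : ℝ) ≤ t := by
    have : (n : ℝ) * n ≤ n * t := by nlinarith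
    exact le_of_mul_le_mul_left this (by linarith)
  rcases Nat.lt_or_ge 2 r with h3 | h3
  · have h1 : (n : ℝ) ^ 3 ≤ 48 * #(upShadow A) := by
      exact_mod_cast cube_le_card_upShadow h3 hrn hA hcard
    have h2 : (#(upShadow A) : ℝ) ≤ 2 * (n * t) := by nlinarith
    have h4 : (n : ℝ) * n ^ 2 ≤ n * (96 * t) := by nlinarith
    exact le_of_mul_le_mul_left h4 (by linarith)
  -- For `r = 2` the dimension is at most 5, and the trivial bound `n ≤ t` suffices.
  · have : (n : ℝ) ≤ 5 := by exact_mod_cast (by omega : n ≤ 5)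
    nlinarith

end BooleanLattice

/-! ### Application to the family of pairs -/

namespace BooleanLattice

variable {n r a b g h : ℕ} {p : Finset (Finset (Fin n)) × Finset (Finset (Fin n))}

lemma mem_pairFamily : p ∈ pairFamily n r a b g h ↔
    (p.1 ⊆ layer n (r - 1) ∧ p.2 ⊆ layer n (r - 2)) ∧ LayerTwoLinked n (r - 1) p.1 ∧
      #(upClosure n (r - 1) p.1) = a ∧ #(upClosure n (r - 2) p.2) = b ∧
      #(upShadow p.1) = g ∧ #(upShadow p.2) = h ∧ upShadow p.2 ⊆ p.1 := by
  classical
  simp only [pairFamily, mem_filter, mem_product, mem_powerset]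

lemma card_pairClosure (hr : 2 ≤ r) (hp : p ∈ pairFamily n r a b g h) :
    #(pairClosure n r p) = a + b := by
  obtain ⟨_, _, h3, h4, _⟩ := mem_pairFamily.1 hp
  rw [pairClosure, card_union_of_disjoint, h3, h4]
  exact disjoint_of_layers (by omega) (upClosure_subset _ _) (upClosure_subset _ _)

lemma card_nb_pairClosure (hr : 2 ≤ r) (hrn : 2 * r ≤ n + 1) (hp : p ∈ pairFamily n r a b g h) :
    #((upGraph n r hr hrn).nb (pairClosure n r p)) = g + h := by
  obtain ⟨h1, _, _, _, h5, h6, _⟩ := mem_pairFamily.1 hp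
  rw [nb_upGraph, upShadow_pairClosure h1.1 h1.2, card_union_of_disjoint, h5, h6]
  exact disjoint_of_layers (by omega) (upShadow_subset_layer h1.1) (upShadow_subset_layer h1.2)

lemma le_mul_excess_of_mem_pairFamily (hr : 2 ≤ r) (hrn : 2 * r ≤ n + 1)
    (hp : p ∈ pairFamily n r a b g h) : (b : ℝ) ≤ n * ((h : ℝ) - b) := by
  obtain ⟨h1, _, _, h4, _, h6, _⟩ := mem_pairFamily.1 hp
  have := card_le_mul_excess hr hrn (upClosure_subset (r - 2) p.2)
  rwa [upShadow_upClosure h1.2, h4, h6] at this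

lemma sq_le_excess_of_mem_pairFamily (hr : 2 ≤ r) (hrn : 2 * r ≤ n + 1) (hnr : n ≤ 2 * r + 1)
    (hp : p ∈ pairFamily n r a b g h) (ha : n ^ 2 ≤ a) (hag : (a : ℝ) ≤ n * ((g : ℝ) - a)) :
    (n : ℝ) ^ 2 ≤ 96 * ((g : ℝ) - a) := by
  obtain ⟨h1, _, h3, _, h5, _⟩ := mem_pairFamily.1 hp
  have := sq_le_excess hr hrn hnr (upClosure_subset (r - 1) p.1)
  rw [upShadow_upClosure h1.1, h3, h5] at this
  exact this ha hag

/-- The pairs of `pairFamily` as a weighted family of closed sets. -/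
noncomputable def pairClosedFamily (hr : 2 ≤ r) (hrn : 2 * r ≤ n + 1) (hnr : n ≤ 2 * r + 1)
    (hne : (pairFamily n r a b g h).Nonempty) (ha : n ^ 2 ≤ a)
    (hag : (a : ℝ) ≤ n * ((g : ℝ) - a)) {lam : ℝ} (hlam : 0 < lam)
    (hΛ : 30000 * (Real.log n ^ 2 / √n) ≤ Real.log (1 + lam)) :
    (upGraph n r hr hrn).ClosedFamily (Finset (Finset (Fin n)) × Finset (Finset (Fin n))) where
  P := pairFamily n r a b g h
  C := pairClosure n r
  W p := lam ^ ((#p.1 : ℤ) + (#p.2 : ℤ) - (h : ℤ))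
  c := a + b
  g := g + h
  T := ((g : ℝ) - a) + ((h : ℝ) - b)
  h := h
  Λ := Real.log (1 + lam)
  W_nonneg p _ := by positivity
  closed p hp := by
    obtain ⟨h1, _⟩ := mem_pairFamily.1 hp
    exact isClosedSet_pairClosure hr hrn h1.1 h1.2
  card_C p hp := card_pairClosure hr hp
  card_nb p hp := card_nb_pairClosure hr hrn hp
  T_eq := by push_cast; ring
  c_le := by
    obtain ⟨p, hp⟩ := hne
    have := le_mul_excess_of_mem_pairFamily hr hrn hp
    change ((a + b : ℕ) : ℝ) ≤ (n : ℝ) * _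
    push_cast
    linarith
  le_g := by
    change n ^ 2 ≤ g + h
    have h1 : (0 : ℝ) < n := by exact_mod_cast (by omega : 0 < n)
    have h2 : (0 : ℝ) ≤ (g : ℝ) - a := nonneg_of_mul_nonneg_right
      ((Nat.cast_nonneg a).trans hag) h1
    have h3 : a ≤ g := by exact_mod_cast (by linarith : (a : ℝ) ≤ g)
    omega
  le_T := by
    obtain ⟨p, hp⟩ := hne
    have h1 := le_mul_excess_of_mem_pairFamily hr hrn hp
    have h2 := sq_le_excess_of_mem_pairFamily hr hrn hnr hp ha hag
    have h3 : (0 : ℝ) < n := by exact_mod_cast (by omega : 0 < n)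
    have h4 : (0 : ℝ) ≤ (h : ℝ) - b := nonneg_of_mul_nonneg_right
      ((Nat.cast_nonneg b).trans h1) h3
    change (n : ℝ) ^ 2 ≤ _
    linarith
  le_Λ := hΛ
  sum_le S hS := by
    refine sum_pairs_le hlam (by omega : r - 1 ≠ r - 2) hS fun p hp => ?_
    rw [mem_filter] at hp
    obtain ⟨h1, _, _, _, _, h6, h7⟩ := mem_pairFamily.1 hp.1
    exact ⟨h1.1, h1.2, (subset_upClosure h1.1).trans (subset_union_left.trans hp.2),
      (subset_upClosure h1.2).trans (subset_union_right.trans hp.2), h7, h6⟩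

lemma sum_pairFamily_le (hr : 2 ≤ r) (hrn : 2 * r ≤ n + 1) (hnr : n ≤ 2 * r + 1) (ha : n ^ 2 ≤ a)
    (hag : (a : ℝ) ≤ n * ((g : ℝ) - a)) {lam : ℝ} (hlam : 0 < lam)
    (hΛ : 30000 * (Real.log n ^ 2 / √n) ≤ Real.log (1 + lam)) :
    ∑ p ∈ pairFamily n r a b g h, lam ^ ((#p.1 : ℤ) + (#p.2 : ℤ) - (h : ℤ)) ≤
      (1 + lam) ^ ((g : ℝ) - 1 / 2 / √n * (((g : ℝ) - a) + ((h : ℝ) - b))) := by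
  rcases (pairFamily n r a b g h).eq_empty_or_nonempty with he | hne
  · rw [he, sum_empty]
    exact Real.rpow_nonneg (by linarith) _
  have key := (pairClosedFamily hr hrn hnr hne ha hag hlam hΛ).sum_weight_le
    (le_of_eq (by rw [Fintype.card_finset, Fintype.card_fin]; rfl))
    (fun x => card_ball_le 14 x) (by
      intro p hp Z h1 h2
      obtain ⟨h3, h4, _, _, _, _, h5⟩ := mem_pairFamily.1 hp
      exact isLinkedBy_of_near hr hrn h3.1 h3.2 h5 h4 h1 h2)
  refine key.trans (le_of_eq ?_)
  rw [Real.rpow_def_of_pos (by linarith)]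
  congr 1
  change Real.log (1 + lam) * (((g + h : ℕ) : ℝ) - (((g : ℝ) - a) + ((h : ℝ) - b)) / (2 * √(n : ℝ))
    - h) = _
  push_cast
  ring

end BooleanLattice

theorem theorem3p5 :
    ∃ C C' : ℝ, 0 < C ∧ 0 < C' ∧
      ∀ (n r : ℕ), 2 ≤ r → (r = n / 2 ∨ r = (n + 1) / 2) →
      ∀ (a b g h : ℕ), n ^ 2 ≤ a → (1 + 1 / (n : ℝ)) * (a : ℝ) ≤ (g : ℝ) →
      ∀ (lam : ℝ), C * Real.logb 2 (n : ℝ) ^ 2 / Real.sqrt (n : ℝ) ≤ lam →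
        ∑ p ∈ BooleanLattice.pairFamily n r a b g h,
            lam ^ ((#p.1 : ℤ) + (#p.2 : ℤ) - (h : ℤ)) ≤
          (1 + lam) ^ ((g : ℝ) -
            C' / Real.sqrt (n : ℝ) * (((g : ℝ) - (a : ℝ)) + ((h : ℝ) - (b : ℝ)))) := by
  -- The container bound needs `log (1 + lam) ≥ 30000 log² n / √n`; the number 16 bounds `log² n /
  -- √n`.
  refine ⟨30000 * Real.exp (30000 * 16), 1 / 2, by positivity, by norm_num, ?_⟩
  intro n r hr hrn a b g h ha hag lam hlam
  have hn3 : (3 : ℝ) ≤ n := by exact_mod_cast (by omega : 3 ≤ n)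
  have hn0 : (0 : ℝ) < n := by linarith
  have hlog : 0 < Real.log n := Real.log_pos (by linarith)
  have hs : 0 < √(n : ℝ) := Real.sqrt_pos.2 hn0
  have hlam' : 30000 * Real.exp (30000 * 16) * (Real.log n ^ 2 / √n) ≤ lam := by
    refine le_trans ?_ hlam
    rw [mul_div_assoc]
    have := pow_le_pow_left₀ hlog.le (BooleanLattice.log_le_logb_two (by linarith : 1 ≤ (n : ℝ))) 2
    gcongr
  refine BooleanLattice.sum_pairFamily_le hr (by omega) (by omega) ha ?_
    (lt_of_lt_of_le (by positivity) hlam')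
    (BooleanLattice.le_log_one_add (by positivity)
      (BooleanLattice.log_sq_div_sqrt_le (by linarith)) (by norm_num) rfl hlam')
  have e : (1 + 1 / (n : ℝ)) * (a : ℝ) = a + a / n := by ring
  rw [e] at hag
  have h1 : (a : ℝ) / n ≤ (g : ℝ) - a := by linarith
  rw [div_le_iff₀ hn0] at h1
  linarith
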